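/- Fix $p\in[0,1]$, $\sigma>0$, $\kappa>0$ and, for every $d$, a vector $r=r_d\in\mathbb R^d$ with $|r|^2=d$. Let $z\sim\mathcal N(0,\mathrm{Id}_d)$ and $a\sim p\,\mathcal N(r,\sigma^2\mathrm{Id}_d)+(1-p)\,\mathcal N(-r,\sigma^2\mathrm{Id}_d)$ be independent, and for $d>\kappa^2$ let $$\tau_t=\begin{cases}\frac{2\kappa t}{\sqrt d}, & t\in[0,\tfrac12],\\ \frac{\kappa}{\sqrt d}+\bigl(1-\frac{\kappa}{\sqrt d}\bigr)(2t-1), & t\in[\tfrac12,1],\end{cases}\qquad I_t=\sqrt{1-\tau_t^2}\,z+\tau_t a .$$ Let $b_t(x)=\mathbb E[\dot I_t\mid I_t=x]$, $t\in[0,1)$, be the velocity field of the probability flow ODE (continuous version in $x$; $\dot I_t$ is the derivative from the right, which matters only at $t=\tfrac12$). Let $X^{\Delta t}_t$, $\Delta t=1/N$, be the Euler discretization of $\dot X_t=b_t(X_t)$, $X_0\sim\mathcal N(0,\mathrm{Id}_d)$, on the uniform grid with $N$ steps of $[0,1]$, interpolated affinely between grid points. Below, $\lim_{\Delta t\to0}\lim_{d\to\infty}$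 is an iterated limit along $N\to\infty$ (the inner limit being required for all sufficiently large $N$); limits of random quantities are limits in law of all joint distributions at finitely many times. Then, for all $N\ge1$, $d>\kappa^2$ and $t\in[0,1]$, $$X^{\Delta t}_t-\frac{r\cdot X^{\Delta t}_t}{d}\,r\sim\mathcal N\bigl(0,(\sigma^{\Delta t,d}_t)^2\,\mathrm{Id}_{d-1}\bigr)\quad\text{on } r^\perp,$$ for some $\sigma_t^{\Delta t,d}\ge0$, and: **First phase.** For $t\in[0,\tfrac12]$, $\lim_{\Delta t\to0}\lim_{d\to\infty}\sigma^{\Delta t,d}_t=1$. The limit process $\mu_t=\lim_{\Delta t\to0}\lim_{d\to\infty} r\cdot X^{\Delta t}_t/\sqrt d$, $t\in[0,\tfrac12]$, exists, satisfies $\mu_0\sim\mathcal N(0,1)$, and its paths almost surely solve $$\dot\mu_t=2\kappa\tanh(h+2\kappa t\mu_t),$$ where $p=e^h/(e^h+e^{-h})$ (for $p=1$ and $p=0$, that is $h=\pm\infty$, the right-hand side is $2\kappa$ and $-2\kappa$, respectively). Moreover $\mu_{1/2}\sim p\,\mathcal N(\kappa,1)+(1-p)\,\mathcal N(-\kappa,1)$.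 **Second phase.** For $t\in[\tfrac12,1]$, $\lim_{\Delta t\to0}\lim_{d\to\infty}\sigma^{\Delta t,d}_t=\sqrt{1+(\sigma^2-1)(2t-1)^2}$. Along grids with an even number $N$ of steps (for which $t=\tfrac12$ is a grid point), and likewise along grids with an odd number of steps, the limit process $M_t=\lim_{\Delta t\to0}\lim_{d\to\infty} r\cdot X^{\Delta t}_t/d$, $t\in[\tfrac12,1]$, exists, and almost surely it is continuous on $[\tfrac12,1]$ and satisfies, for $t\in(\tfrac12,1)$, $$\dot M_t=\frac{2(\sigma^2-1)(2t-1)}{1+(\sigma^2-1)(2t-1)^2}\,M_t+\frac{2\,\mathrm{sgn}(M_t)}{1+(\sigma^2-1)(2t-1)^2}.$$ Furthermore $M_1\sim p^\kappa\delta_1+(1-p^\kappa)\delta_{-1}$, where $p^\kappa\in[0,1]$ depends only on $p$, $\kappa$ and the parity of $N$, and for each parity $\lim_{\kappa\to\infty}p^\kappa=p$. -/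

import Mathlib

open MeasureTheory ProbabilityTheory Filter Topology

noncomputable section

namespace DilatedVP

/-- The Euclidean space `ℝ^d`. -/
abbrev Space (d : ℕ) : Type := EuclideanSpace ℝ (Fin d)

/-- The Gaussian mixture `p N(r, σ² Id) + (1 - p) N(-r, σ² Id)` on `ℝ^d`. -/
def gaussianMixture (p σ : ℝ) {d : ℕ} (r : Space d) : Measure (Space d) :=
  ENNReal.ofReal p • (stdGaussian (Space d)).map (fun x => r + σ • x)
    + ENNReal.ofReal (1 - p) • (stdGaussian (Space d)).map (fun x => -r + σ • x)

/-- The time dilation `τ_t`. -/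
def dilation (κ : ℝ) (d : ℕ) (t : ℝ) : ℝ :=
  if t ≤ 1 / 2 then 2 * κ * t / √(d : ℝ)
  else κ / √(d : ℝ) + (1 - κ / √(d : ℝ)) * (2 * t - 1)

/-- The dilated interpolant `I_t = √(1 - τ_t²) z + τ_t a`, as a function of `(z, a)`. -/
def interpolant (κ : ℝ) {d : ℕ} (t : ℝ) (za : Space d × Space d) : Space d :=
  √(1 - dilation κ d t ^ 2) • za.1 + dilation κ d t • za.2

/-- The time derivative of `I_t`. It is the derivative from the right, which differs from the
two-sided one only at the kink `t = 1/2` of the dilation. -/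
def interpolantDot (κ : ℝ) {d : ℕ} (t : ℝ) (za : Space d × Space d) : Space d :=
  derivWithin (fun s => interpolant κ s za) (Set.Ici t) t

/-- The law of `(z, a)`: `z` is standard Gaussian, `a` has the Gaussian mixture law, and they are
independent. -/
def couplingLaw (p σ : ℝ) {d : ℕ} (r : Space d) : Measure (Space d × Space d) :=
  (stdGaussian (Space d)).prod (gaussianMixture p σ r)

/-- `b` is the continuous version of the conditional expectation `x ↦ E[İ_t | I_t = x]`. -/
def IsVelocity (p σ κ : ℝ) {d : ℕ} (r : Space d) (t : ℝ) (b : Space d → Space d) : Prop :=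
  Continuous b ∧
    (fun za => b (interpolant κ t za)) =ᵐ[couplingLaw p σ r]
      (couplingLaw p σ r)[interpolantDot κ t |
        MeasurableSpace.comap (interpolant κ t) inferInstance]

open Classical in
/-- The velocity field `b_t(x) = E[İ_t | I_t = x]` of the probability flow ODE. For `κ < √d` and
`0 ≤ t < 1` the law of `I_t` has full support, so the continuous version is unique. -/
def velocity (p σ κ : ℝ) {d : ℕ} (r : Space d) (t : ℝ) : Space d → Space d :=
  if h : ∃ b, IsVelocity p σ κ r t b then h.choose else 0

/-- The Euler scheme with `N` uniform steps of size `1 / N` on `[0, 1]`, after `k` steps. -/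
def euler (p σ κ : ℝ) {d : ℕ} (r : Space d) (N : ℕ) : ℕ → Space d → Space d
  | 0, x => x
  | k + 1, x =>
    euler p σ κ r N k x
      + (1 / (N : ℝ)) • velocity p σ κ r ((k : ℝ) / N) (euler p σ κ r N k x)

/-- The discretized probability flow `X^{Δt}_t`, `Δt = 1 / N`, started at `x`: the Euler scheme,
interpolated affinely between consecutive grid points. -/
def flow (p σ κ : ℝ) {d : ℕ} (r : Space d) (N : ℕ) (t : ℝ) (x : Space d) : Space d :=
  euler p σ κ r N ⌊t * N⌋₊ x
    + (t - (⌊t * N⌋₊ : ℝ) / N) •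
      velocity p σ κ r ((⌊t * N⌋₊ : ℝ) / N) (euler p σ κ r N ⌊t * N⌋₊ x)

/-- The law of `X_t - (r · X_t / d) r` when `X_0` is standard Gaussian. -/
def orthLaw (p σ κ : ℝ) {d : ℕ} (r : Space d) (N : ℕ) (t : ℝ) : Measure (Space d) :=
  (stdGaussian (Space d)).map fun x =>
    flow p σ κ r N t x - (inner ℝ r (flow p σ κ r N t x) / (d : ℝ)) • r

/-- The centred isotropic Gaussian law with standard deviation `s` on the hyperplane orthogonal
to `r`, seen as a law on `ℝ^d`. -/
def orthGaussian {d : ℕ} (r : Space d) (s : ℝ) : Measure (Space d) :=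
  (stdGaussian ((Submodule.span ℝ {r})ᗮ : Submodule ℝ (Space d))).map
    fun v : ((Submodule.span ℝ {r})ᗮ : Submodule ℝ (Space d)) => s • (v : Space d)

/-- The joint law, when `X_0` is standard Gaussian, of `r · X_t / c` at the times
`t = T 0, …, T (m - 1)`. -/
def overlapLaw (p σ κ : ℝ) {d : ℕ} (r : Space d) (N : ℕ) (c : ℝ) {m : ℕ} (T : Fin m → ℝ) :
    Measure (Fin m → ℝ) :=
  (stdGaussian (Space d)).map fun x i => inner ℝ r (flow p σ κ r N (T i) x) / c

/-- `lim_{n → ∞} lim_{d → ∞} u n d = L`; the inner limits exist for all large `n`. -/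
def IteratedLimit {F : Type*} [TopologicalSpace F] (u : ℕ → ℕ → F) (L : F) : Prop :=
  ∃ ℓ : ℕ → F, (∀ᶠ n in atTop, Tendsto (u n) atTop (𝓝 (ℓ n))) ∧ Tendsto ℓ atTop (𝓝 L)

/-- `lim_{n → ∞} lim_{d → ∞} u n d = L` for probability laws and weak convergence. -/
def IteratedLimitInLaw {F : Type*} [TopologicalSpace F] [MeasurableSpace F]
    [OpensMeasurableSpace F] (u : ℕ → ℕ → Measure F) (L : Measure F) : Prop :=
  ∃ (u' : ℕ → ℕ → ProbabilityMeasure F) (L' : ProbabilityMeasure F),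
    (∀ n d, (u' n d : Measure F) = u n d) ∧ (L' : Measure F) = L ∧ IteratedLimit u' L'

end DilatedVP

end

/-! Conditionally on the mode `s = ±1`, the interpolant is Gaussian with mean `s τ r` and covariance
`V Id`, where `V = 1 + (σ² - 1) τ²`. Gaussian conditioning then gives the velocity in closed form
(`velocity_eq`): `(w / V) • ((σ² - 1) τ • x + β • r)`, with `w` the speed of the dilation and `β =
bias p (τ r·x / V)` the posterior mean of `s`. This field respects the splitting along `r` and
`r^⊥`. The orthogonal part of the Euler scheme is therefore multiplied by a deterministic scalar,
while `μ = r·X/√d` follows an autonomous scalar scheme started from `N(0,1)` (`flow_eq_assemble`).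
All overlaps become functions of one real Gaussian `ω`, so limits in law follow from almost sure
limits of scalar schemes.

Orthogonal part: as `d → ∞` the dilation tends to `θ = max 0 (2t - 1)`, and the limiting linear
scheme approximates an equation solved by `√V(θ)`.

First phase: `τ √d = 2κt` and `w √d = 2κ`, so the scheme for `μ` tends to the Euler scheme of a
Lipschitz equation with field `2κ bias p (2κtμ)`. The function `p Φ(x - 2κt) + (1 - p) Φ(x + 2κt)`
is constant along its solutions, `Φ` being the normal distribution function; this identifies the law
at `t = 1/2`.

Second phase: on the scale `M = r·X/d` the scheme starts from `0`. For almost every `ω` its first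
step is governed by a nonzero posterior mean `B`: on even grids `B = bias p (κμ)`, and on odd grids,
when `0 < p < 1`, `B` is the sign of `μ`, since the argument of `bias` already diverges. From then
on that argument is of order `d` and the posterior mean is saturated at `S = sgn B`. The function `S
θ` is invariant under the resulting scheme and each step only multiplies the deviation from it
(`secondField_step`). The deviation is `O(1/N)` after the first step, so `M` tends to `S (2t - 1)`.
The weight of the mode `+1` is the mass that the mixture `N(±κ, 1)` puts on `B > 0`. This is a
half-line when `0 < p < 1`, with threshold bounded as `κ → ∞`, so the weight tends to `p`. -/

noncomputable section

/-! ### Standard Gaussians: resampling, Cameron–Martin, rotations -/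

section Gaussian

variable {E : Type*} [NormedAddCommGroup E] [InnerProductSpace ℝ E] [FiniteDimensional ℝ E]
  [MeasurableSpace E] [BorelSpace E]

/-- Resampling the component along a unit vector preserves the standard Gaussian law. -/
lemma stdGaussian_eq_map_add_proj {e : E} (he : ‖e‖ = 1) :
    stdGaussian E = ((gaussianReal 0 1).prod (stdGaussian E)).map
      (fun q : ℝ × E => q.1 • e + (q.2 - (inner ℝ e q.2 : ℝ) • e)) := by
  have hm : Measurable (fun q : ℝ × E => q.1 • e + (q.2 - (inner ℝ e q.2 : ℝ) • e)) := by
    fun_prop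
  have : IsProbabilityMeasure (((gaussianReal 0 1).prod (stdGaussian E)).map
      (fun q : ℝ × E => q.1 • e + (q.2 - (inner ℝ e q.2 : ℝ) • e))) :=
    Measure.isProbabilityMeasure_map hm.aemeasurable
  apply Measure.ext_of_charFun
  ext ξ
  rw [charFun_stdGaussian, charFun_apply, integral_map hm.aemeasurable (by fun_prop)]
  -- The projection along `e` is self-adjoint, so the phase splits into a term in `q.1` and a term
  -- in `q.2` and the characteristic function factorizes.
  have key : ∀ q : ℝ × E,
      Complex.exp ((inner ℝ (q.1 • e + (q.2 - (inner ℝ e q.2 : ℝ) • e)) ξ : ℝ) * Complex.I) =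
      Complex.exp (((inner ℝ e ξ : ℝ) : ℂ) * (q.1 : ℂ) * Complex.I) *
        Complex.exp ((inner ℝ q.2 (ξ - (inner ℝ e ξ : ℝ) • e) : ℝ) * Complex.I) := by
    intro q
    rw [← Complex.exp_add]
    congr 1
    simp only [inner_add_left, inner_sub_left, inner_sub_right, inner_smul_left, inner_smul_right,
      real_inner_comm e q.2]
    simp only [conj_trivial]
    push_cast
    ring
  simp_rw [key]
  rw [integral_prod_mul (μ := gaussianReal 0 1) (ν := stdGaussian E)
    (fun g : ℝ => Complex.exp (((inner ℝ e ξ : ℝ) : ℂ) * (g : ℂ) * Complex.I))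
    (fun y : E => Complex.exp ((inner ℝ y (ξ - (inner ℝ e ξ : ℝ) • e) : ℝ) * Complex.I)),
    ← charFun_apply, charFun_stdGaussian, ← charFun_apply_real, charFun_gaussianReal,
    ← Complex.exp_add]
  congr 1
  have hn : ‖ξ - (inner ℝ e ξ : ℝ) • e‖ ^ 2 = ‖ξ‖ ^ 2 - (inner ℝ e ξ : ℝ) ^ 2 := by
    rw [norm_sub_sq_real, norm_smul, he, inner_smul_right, real_inner_comm]
    simp only [Real.norm_eq_abs, mul_one, sq_abs]
    ring
  rw [← Complex.ofReal_pow ‖ξ - _‖, hn]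
  push_cast
  ring

/-- The exponential is the ratio of the densities of `N(c, 1)` and `N(0, 1)`. -/
lemma lintegral_gaussianReal_add (c : ℝ) {f : ℝ → ENNReal} (hf : Measurable f) :
    ∫⁻ g, f (g + c) ∂gaussianReal 0 1
      = ∫⁻ g, ENNReal.ofReal (Real.exp (c * g - c ^ 2 / 2)) * f g ∂gaussianReal 0 1 := by
  rw [← lintegral_map (f := f) (g := fun g => g + c) hf (by fun_prop),
    gaussianReal_map_add_const, zero_add, gaussianReal_of_var_ne_zero _ one_ne_zero,
    gaussianReal_of_var_ne_zero _ one_ne_zero,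
    lintegral_withDensity_eq_lintegral_mul _ (by fun_prop) hf,
    lintegral_withDensity_eq_lintegral_mul _ (by fun_prop) (by fun_prop)]
  refine lintegral_congr fun x => ?_
  simp only [Pi.mul_apply, gaussianPDF, ← mul_assoc]
  rw [← ENNReal.ofReal_mul (gaussianPDFReal_nonneg _ _ _)]
  congr 2
  simp only [gaussianPDFReal, mul_assoc, ← Real.exp_add]
  congr 2
  simp
  ring

/-- The Cameron–Martin formula for nonnegative functions. -/
lemma lintegral_stdGaussian_add (w : E) {f : E → ENNReal} (hf : Measurable f) :
    ∫⁻ u, f (u + w) ∂stdGaussian E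
      = ∫⁻ u, ENNReal.ofReal (Real.exp (inner ℝ w u - ‖w‖ ^ 2 / 2)) * f u ∂stdGaussian E := by
  by_cases hw : w = 0
  · simp [hw]
  have hw' : ‖w‖ ≠ 0 := norm_ne_zero_iff.2 hw
  set e : E := ‖w‖⁻¹ • w with he_def
  have he : ‖e‖ = 1 := by rw [he_def, norm_smul, norm_inv, norm_norm, inv_mul_cancel₀ hw']
  have hwe : w = ‖w‖ • e := by rw [he_def, smul_smul, mul_inv_cancel₀ hw', one_smul]
  -- After resampling along `e = w/‖w‖`, the shift by `w` moves only the real coordinate, and the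
  -- one-dimensional formula applies for fixed orthogonal part.
  rw [stdGaussian_eq_map_add_proj he, lintegral_map (by fun_prop) (by fun_prop),
    lintegral_map (by fun_prop) (by fun_prop), lintegral_prod_symm _ (by fun_prop),
    lintegral_prod_symm _ (by fun_prop)]
  refine lintegral_congr fun y => ?_
  dsimp only
  have h1 : ∀ g : ℝ, g • e + (y - (inner ℝ e y : ℝ) • e) + w
      = (g + ‖w‖) • e + (y - (inner ℝ e y : ℝ) • e) := by
    intro g; conv_lhs => rw [hwe]
    module
  simp_rw [h1]
  rw [lintegral_gaussianReal_add ‖w‖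
    (f := fun g => f (g • e + (y - (inner ℝ e y : ℝ) • e))) (by fun_prop)]
  refine lintegral_congr fun g => ?_
  congr 4
  conv_rhs => rw [hwe]
  simp only [inner_smul_left, inner_add_right, inner_sub_right, inner_smul_right,
    real_inner_self_eq_norm_sq, he]
  simp
  ring

/-- The Cameron–Martin formula. -/
lemma integral_stdGaussian_add (w : E) {F : E → ℝ} (hF : Measurable F) :
    ∫ u, F (u + w) ∂stdGaussian E
      = ∫ u, Real.exp (inner ℝ w u - ‖w‖ ^ 2 / 2) * F u ∂stdGaussian E := by
  have hmeas : (stdGaussian E).map (fun u => u + w) = (stdGaussian E).withDensity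
      (fun u => ENNReal.ofReal (Real.exp (inner ℝ w u - ‖w‖ ^ 2 / 2))) := by
    refine Measure.ext_of_lintegral _ fun f hf => ?_
    rw [lintegral_map hf (by fun_prop), lintegral_stdGaussian_add w hf,
      lintegral_withDensity_eq_lintegral_mul _ (by fun_prop) hf]
    rfl
  rw [← integral_map (φ := fun u => u + w) (f := F) (by fun_prop) hF.aestronglyMeasurable, hmeas,
    integral_withDensity_eq_integral_toReal_smul (by fun_prop) (by simp)]
  refine integral_congr_ae (ae_of_all _ fun u => ?_)
  simp [ENNReal.toReal_ofReal (Real.exp_nonneg _)]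

/-- Full support is what makes the continuous version of the velocity unique. -/
instance isOpenPosMeasure_stdGaussian : (stdGaussian E).IsOpenPosMeasure := by
  have : (gaussianReal 0 1).IsOpenPosMeasure :=
    (gaussianReal_absolutelyContinuous' 0 one_ne_zero).isOpenPosMeasure
  refine Continuous.isOpenPosMeasure_map (by fun_prop) fun x => ?_
  exact ⟨(stdOrthonormalBasis ℝ E).repr x, (stdOrthonormalBasis ℝ E).sum_repr x⟩

/-- A rotation mixing two independent standard Gaussians. -/
lemma stdGaussian_prod_map_rotation {a b : ℝ} (h : a ^ 2 + b ^ 2 = 1) :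
    ((stdGaussian E).prod (stdGaussian E)).map
      (fun q : E × E => (a • q.1 + b • q.2, -b • q.1 + a • q.2))
      = (stdGaussian E).prod (stdGaussian E) := by
  -- The rotation angle is the argument of the unit complex number `a + ib`.
  have hn : ‖(⟨a, b⟩ : ℂ)‖ = 1 := by
    rw [Complex.norm_def, Complex.normSq_mk, ← sq, ← sq, h, Real.sqrt_one]
  have hc := Complex.norm_mul_cos_arg ⟨a, b⟩
  have hs := Complex.norm_mul_sin_arg ⟨a, b⟩
  rw [hn, one_mul] at hc hs
  have := IsGaussian.map_rotation_eq_self (μ := stdGaussian E) (by simp)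
    (Complex.arg ⟨a, b⟩)
  convert this using 2
  ext q <;> simp [ContinuousLinearMap.rotation_apply, hc, hs]

/-- A linear combination of two independent standard Gaussians, together with an orthogonal one. -/
lemma stdGaussian_prod_map_normalized {α β V : ℝ} (hV : 0 < V) (h : α ^ 2 + β ^ 2 = V) :
    (stdGaussian E).prod (stdGaussian E) = ((stdGaussian E).prod (stdGaussian E)).map
      (fun q : E × E => ((α / √V) • q.1 - (β / √V) • q.2, (β / √V) • q.1 + (α / √V) • q.2)) := by
  have h' : (α / √V) ^ 2 + (-(β / √V)) ^ 2 = 1 := by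
    rw [neg_sq, div_pow, div_pow, Real.sq_sqrt hV.le]; field_simp; linarith
  rw [← stdGaussian_prod_map_rotation (E := E) h']
  conv_rhs => rw [stdGaussian_prod_map_rotation (E := E) h']
  congr 1
  ext q <;> simp [sub_eq_add_neg]

end Gaussian
end

noncomputable section

/-! ### The closed form of the velocity field -/

namespace DilatedVP

/-- The variance of the noise of the interpolant at dilated time `τ`. -/
def noiseVar (σ τ : ℝ) : ℝ := 1 + (σ ^ 2 - 1) * τ ^ 2

lemma noiseVar_eq (σ τ : ℝ) : noiseVar σ τ = (1 - τ ^ 2) + (τ * σ) ^ 2 := by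
  unfold noiseVar; ring

lemma noiseVar_pos {σ τ : ℝ} (hσ : 0 < σ) (h0 : 0 ≤ τ) (h1 : τ ≤ 1) : 0 < noiseVar σ τ := by
  rw [noiseVar_eq]
  rcases h1.eq_or_lt with rfl | h
  · simpa using by positivity
  · have : 0 < 1 - τ ^ 2 := by nlinarith
    positivity

/-- The posterior mean of the sign with prior `p` and log-likelihood ratio `2 u`. -/
def bias (p u : ℝ) : ℝ :=
  (p * Real.exp u - (1 - p) * Real.exp (-u)) / (p * Real.exp u + (1 - p) * Real.exp (-u))

lemma bias_denom_pos {p : ℝ} (hp : p ∈ Set.Icc (0 : ℝ) 1) (u : ℝ) :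
    0 < p * Real.exp u + (1 - p) * Real.exp (-u) := by
  have h1 := Real.exp_pos u
  have h2 := Real.exp_pos (-u)
  rcases hp.1.eq_or_lt with rfl | h
  · simpa using h2
  · have : 0 ≤ (1 - p) * Real.exp (-u) := mul_nonneg (by linarith [hp.2]) h2.le
    positivity

lemma continuous_bias {p : ℝ} (hp : p ∈ Set.Icc (0 : ℝ) 1) : Continuous (bias p) := by
  unfold bias
  exact Continuous.div (by fun_prop) (by fun_prop) fun u => (bias_denom_pos hp u).ne'

lemma abs_bias_le {p : ℝ} (hp : p ∈ Set.Icc (0 : ℝ) 1) (u : ℝ) : |bias p u| ≤ 1 := by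
  have h := bias_denom_pos hp u
  have h1 := mul_nonneg hp.1 (Real.exp_pos u).le
  have h2 : 0 ≤ (1 - p) * Real.exp (-u) := mul_nonneg (by linarith [hp.2]) (Real.exp_pos (-u)).le
  rw [bias, abs_div, abs_of_pos h, div_le_one h, abs_le]
  constructor <;> linarith

lemma hasDerivAt_bias {p : ℝ} (hp : p ∈ Set.Icc (0 : ℝ) 1) (u : ℝ) :
    HasDerivAt (bias p)
      (4 * p * (1 - p) / (p * Real.exp u + (1 - p) * Real.exp (-u)) ^ 2) u := by
  have h := bias_denom_pos hp u
  have he : HasDerivAt (fun u : ℝ => Real.exp (-u)) (-Real.exp (-u)) u := by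
    simpa using (hasDerivAt_neg u).exp
  have h1 := (((Real.hasDerivAt_exp u).const_mul p).sub (he.const_mul (1 - p))).div
    (((Real.hasDerivAt_exp u).const_mul p).add (he.const_mul (1 - p))) h.ne'
  refine h1.congr_deriv ?_
  congr 1
  have : Real.exp u * Real.exp (-u) = 1 := by rw [← Real.exp_add]; simp
  simp only [Pi.add_apply, Pi.sub_apply]
  linear_combination 4 * p * (1 - p) * this

lemma monotone_bias {p : ℝ} (hp : p ∈ Set.Icc (0 : ℝ) 1) : Monotone (bias p) := by
  refine monotone_of_hasDerivAt_nonneg (fun u => hasDerivAt_bias hp u) fun u => ?_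
  have := hp.1
  have : 0 ≤ 1 - p := by linarith [hp.2]
  simp only [Pi.zero_apply]
  positivity

/-- As `e^u e^{-u} = 1`, the numerator of the derivative is four times the product of the two
summands whose sum is squared in the denominator; it is at most one by the arithmetic-geometric mean
inequality. -/
lemma abs_bias_sub_le {p : ℝ} (hp : p ∈ Set.Icc (0 : ℝ) 1) (u v : ℝ) :
    |bias p u - bias p v| ≤ |u - v| := by
  have := Convex.norm_image_sub_le_of_norm_hasDerivWithin_le (f := bias p) (C := 1)
    (s := Set.univ) (x := v) (y := u)
    (fun u _ => (hasDerivAt_bias hp u).hasDerivWithinAt) (fun u _ => ?_) convex_univ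
    (Set.mem_univ _) (Set.mem_univ _)
  · simpa using this
  have h := bias_denom_pos hp u
  have hp0 := hp.1
  have hp1 : 0 ≤ 1 - p := by linarith [hp.2]
  have he : Real.exp u * Real.exp (-u) = 1 := by rw [← Real.exp_add]; simp
  rw [Real.norm_of_nonneg (by positivity), div_le_one (by positivity)]
  nlinarith [sq_nonneg (p * Real.exp u - (1 - p) * Real.exp (-u))]

section Velocity

variable {d : ℕ}

/-- Conditioning on the mode leaves two independent standard Gaussians. The modes are written `(±1)
• r` so that one computation with a parameter `s` serves both. -/
lemma couplingLaw_eq (p σ : ℝ) (r : Space d) :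
    couplingLaw p σ r =
      ENNReal.ofReal p • ((stdGaussian (Space d)).prod (stdGaussian (Space d))).map
          (fun q => (q.1, (1 : ℝ) • r + σ • q.2))
        + ENNReal.ofReal (1 - p) • ((stdGaussian (Space d)).prod (stdGaussian (Space d))).map
          (fun q => (q.1, (-1 : ℝ) • r + σ • q.2)) := by
  have h : ∀ s : Space d, (stdGaussian (Space d)).prod
      ((stdGaussian (Space d)).map (fun x => s + σ • x)) =
      ((stdGaussian (Space d)).prod (stdGaussian (Space d))).map (fun q => (q.1, s + σ • q.2)) := by
    intro s
    have := Measure.map_prod_map (stdGaussian (Space d)) (stdGaussian (Space d))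
      (f := id) (g := fun x => s + σ • x) measurable_id (by fun_prop)
    rw [Measure.map_id] at this
    rw [this]; rfl
  have : ∀ s : Space d, IsFiniteMeasure ((stdGaussian (Space d)).map (fun x => s + σ • x)) :=
    fun s => by infer_instance
  rw [couplingLaw, gaussianMixture, Measure.prod_add, Measure.prod_smul_right,
    Measure.prod_smul_right, h, h]
  simp

instance isFiniteMeasure_couplingLaw (p σ : ℝ) (r : Space d) :
    IsFiniteMeasure (couplingLaw p σ r) := by
  rw [couplingLaw_eq]
  have h : ∀ (c : ℝ) (s : ℝ), IsFiniteMeasure (ENNReal.ofReal c •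
      ((stdGaussian (Space d)).prod (stdGaussian (Space d))).map
          (fun q => (q.1, s • r + σ • q.2))) := fun c s =>
    Measure.smul_finite _ ENNReal.ofReal_ne_top
  have := h p 1
  have := h (1 - p) (-1)
  infer_instance

lemma integrable_couplingLaw {F : Type*} [NormedAddCommGroup F]
    {p σ : ℝ} {r : Space d} {f : Space d × Space d → F} (hfc : Continuous f)
    (hf : ∀ s : ℝ, Integrable (fun q : Space d × Space d => f (q.1, s • r + σ • q.2))
      ((stdGaussian (Space d)).prod (stdGaussian (Space d)))) :
    Integrable f (couplingLaw p σ r) := by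
  rw [couplingLaw_eq]
  refine Integrable.add_measure ?_ ?_ <;>
  · refine Integrable.smul_measure ?_ ENNReal.ofReal_ne_top
    rw [integrable_map_measure hfc.aestronglyMeasurable (by fun_prop)]
    exact hf _

lemma setIntegral_couplingLaw {F : Type*} [NormedAddCommGroup F] [NormedSpace ℝ F]
    {p σ : ℝ} (hp : p ∈ Set.Icc (0 : ℝ) 1) {r : Space d} {f : Space d × Space d → F}
    (hfc : Continuous f)
    (hf : ∀ s : ℝ, Integrable (fun q : Space d × Space d => f (q.1, s • r + σ • q.2))
      ((stdGaussian (Space d)).prod (stdGaussian (Space d))))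
    {S : Set (Space d × Space d)} (hS : MeasurableSet S) :
    ∫ q in S, f q ∂couplingLaw p σ r =
      p • ∫ q in {q | (q.1, (1 : ℝ) • r + σ • q.2) ∈ S}, f (q.1, (1 : ℝ) • r + σ • q.2)
          ∂((stdGaussian (Space d)).prod (stdGaussian (Space d)))
      + (1 - p) • ∫ q in {q | (q.1, (-1 : ℝ) • r + σ • q.2) ∈ S}, f (q.1, (-1 : ℝ) • r + σ • q.2)
          ∂((stdGaussian (Space d)).prod (stdGaussian (Space d))) := by
  have hi : ∀ s : ℝ, Integrable f (((stdGaussian (Space d)).prod (stdGaussian (Space d))).map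
          (fun q => (q.1, s • r + σ • q.2))) := fun s => by
    rw [integrable_map_measure hfc.aestronglyMeasurable (by fun_prop)]
    exact hf s
  rw [couplingLaw_eq, Measure.restrict_add, Measure.restrict_smul, Measure.restrict_smul,
    integral_add_measure, integral_smul_measure, integral_smul_measure,
    setIntegral_map hS hfc.aestronglyMeasurable (by fun_prop),
    setIntegral_map hS hfc.aestronglyMeasurable (by fun_prop),
    ENNReal.toReal_ofReal hp.1, ENNReal.toReal_ofReal (by linarith [hp.2])]
  · rfl
  · exact ((hi 1).integrableOn).smul_measure ENNReal.ofReal_ne_top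
  · exact ((hi (-1)).integrableOn).smul_measure ENNReal.ofReal_ne_top

/-- The closed form of the velocity field at dilated time `τ` and speed `w`. -/
def driftField (p σ : ℝ) (r : Space d) (τ w : ℝ) (x : Space d) : Space d :=
  (w / noiseVar σ τ) • (((σ ^ 2 - 1) * τ) • x + bias p (τ * inner ℝ r x / noiseVar σ τ) • r)

lemma continuous_driftField {p : ℝ} (hp : p ∈ Set.Icc (0 : ℝ) 1) (σ : ℝ) (r : Space d)
    (τ w : ℝ) : Continuous (driftField p σ r τ w) := by
  have h : Continuous fun x : Space d => bias p (τ * inner ℝ r x / noiseVar σ τ) :=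
    (continuous_bias hp).comp (by fun_prop)
  unfold driftField
  fun_prop

lemma integrable_fst_stdGaussian : Integrable (fun q : Space d × Space d => q.1)
    ((stdGaussian (Space d)).prod (stdGaussian (Space d))) :=
  Integrable.comp_fst (f := fun x : Space d => x) IsGaussian.integrable_id _

lemma integrable_snd_stdGaussian : Integrable (fun q : Space d × Space d => q.2)
    ((stdGaussian (Space d)).prod (stdGaussian (Space d))) :=
  Integrable.comp_snd (f := fun x : Space d => x) IsGaussian.integrable_id _

/-- The difference between the time derivative of the interpolant and the drift field has no
component along functions of the interpolant, up to the uncertainty on the sign `s`. -/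
lemma setIntegral_residual {p σ τ w α A : ℝ} (hp : p ∈ Set.Icc (0 : ℝ) 1)
    (hV : 0 < noiseVar σ τ) (hα : α ^ 2 = 1 - τ ^ 2) (hA : A * α = -(τ * w)) (r : Space d) (s : ℝ)
    {B : Set (Space d)} (hB : MeasurableSet B) :
    ∫ q in {q : Space d × Space d | α • q.1 + τ • (s • r + σ • q.2) ∈ B},
        (A • q.1 + w • (s • r + σ • q.2)
          - driftField p σ r τ w (α • q.1 + τ • (s • r + σ • q.2)))
        ∂((stdGaussian (Space d)).prod (stdGaussian (Space d)))
      = (∫ u, B.indicator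
          (fun x => w / noiseVar σ τ * (s - bias p (τ * inner ℝ r x / noiseVar σ τ)))
          (√(noiseVar σ τ) • u + (s * τ) • r) ∂stdGaussian (Space d)) • r := by
  set V := noiseVar σ τ with hVdef
  set γ := stdGaussian (Space d)
  have hS : 0 < √V := Real.sqrt_pos.2 hV
  have hSS : √V * √V = V := Real.mul_self_sqrt hV.le
  have hVV : α ^ 2 + (τ * σ) ^ 2 = V := by rw [hα, hVdef, noiseVar_eq]
  have hbm : Measurable (bias p) := (continuous_bias hp).measurable
  have hdm := (continuous_driftField hp σ r τ w).measurable
  have hset : MeasurableSet {q : Space d × Space d | α • q.1 + τ • (s • r + σ • q.2) ∈ B} :=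
    hB.preimage (f := fun q : Space d × Space d => α • q.1 + τ • (s • r + σ • q.2)) (by fun_prop)
  -- In rotated coordinates `(u, v)` the noise of the interpolant is `√V • u` and `v` is independent
  -- of it. The terms of the residual linear in `u` cancel, leaving `F u • r + G u • v`, and the
  -- second summand has mean zero.
  rw [← integral_indicator hset, stdGaussian_prod_map_normalized hV hVV,
    integral_map (by fun_prop)]
  swap
  · refine (Measurable.indicator ?_ hset).aestronglyMeasurable
    fun_prop
  set k : ℝ := (w * σ * α - A * (τ * σ)) / √V with hk
  set F : Space d → ℝ := fun u => B.indicator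
          (fun x => w / V * (s - bias p (τ * inner ℝ r x / V))) (√V • u + (s * τ) • r) with hF
  set G : Space d → ℝ := fun u => B.indicator (fun _ => k) (√V • u + (s * τ) • r) with hG
  have hpt : ∀ q : Space d × Space d,
      {q : Space d × Space d | α • q.1 + τ • (s • r + σ • q.2) ∈ B}.indicator
        (fun q => A • q.1 + w • (s • r + σ • q.2)
          - driftField p σ r τ w (α • q.1 + τ • (s • r + σ • q.2)))
        ((α / √V) • q.1 - (τ * σ / √V) • q.2, (τ * σ / √V) • q.1 + (α / √V) • q.2)
      = F q.1 • r + G q.1 • q.2 := by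
    intro q
    have hx : α • ((α / √V) • q.1 - (τ * σ / √V) • q.2)
        + τ • (s • r + σ • ((τ * σ / √V) • q.1 + (α / √V) • q.2))
        = √V • q.1 + (s * τ) • r := by
      match_scalars
      · field_simp
        rw [pow_two √V, hSS, ← hVV]; ring
      · field_simp; ring
      · ring
    by_cases hq : √V • q.1 + (s * τ) • r ∈ B
    · rw [Set.indicator_of_mem (by rw [Set.mem_ofPred_eq, hx]; exact hq)]
      simp only [hF, hG, Set.indicator_of_mem hq]
      rw [hx]
      unfold driftField
      rw [← hVdef]
      generalize bias p _ = T
      have hk1 : k * √V = w * σ * α - A * (τ * σ) := by rw [hk]; field_simp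
      have hσ2 : σ ^ 2 * τ ^ 2 = V - 1 + τ ^ 2 := by rw [hVdef, noiseVar]; ring
      match_scalars
      · field_simp
        rw [show A * α = -(τ * w) from hA, pow_two √V, hSS]
        ring
      · field_simp
        linear_combination - hk1
      · field_simp
        linear_combination (- s * w) * hσ2
    · rw [Set.indicator_of_notMem (by rw [Set.mem_ofPred_eq, hx]; exact hq)]
      simp [hF, hG, Set.indicator_of_notMem hq]
  simp_rw [hpt]
  have hFm : Measurable F := by
    refine (Measurable.indicator ?_ hB).comp (by fun_prop)
    fun_prop
  have hGm : Measurable G := (measurable_const.indicator hB).comp (by fun_prop)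
  have hFi : Integrable F γ := by
    refine Integrable.of_bound hFm.aestronglyMeasurable (|w / V| * (|s| + 1)) (ae_of_all _ fun u => ?_)
    refine (norm_indicator_le_norm_self _ _).trans ?_
    rw [Real.norm_eq_abs, abs_mul]
    gcongr
    exact (abs_sub _ _).trans (by gcongr; exact abs_bias_le hp _)
  have hGi : Integrable G γ := by
    refine Integrable.of_bound hGm.aestronglyMeasurable |k| (ae_of_all _ fun u => ?_)
    exact norm_indicator_le_norm_self _ _
  have hid : Integrable (fun x : Space d => x) γ := IsGaussian.integrable_id
  rw [integral_add]
  · rw [integral_smul_const, integral_prod_smul (𝕜 := ℝ) G (fun x : Space d => x),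
      integral_id_stdGaussian, smul_zero, add_zero, integral_fun_fst]
    simp
    rfl
  · exact (hFi.comp_fst γ).smul_const r
  · exact hGi.smul_prod hid

/-- The drift field uses the posterior mean of the sign, so the residuals cancel. -/
lemma integral_posterior_sign {p σ τ : ℝ} (hp : p ∈ Set.Icc (0 : ℝ) 1)
    (hV : 0 < noiseVar σ τ) (r : Space d) (c : ℝ) {B : Set (Space d)} (hB : MeasurableSet B) :
    p * (∫ u, B.indicator (fun x => c * (1 - bias p (τ * inner ℝ r x / noiseVar σ τ)))
          (√(noiseVar σ τ) • u + (1 * τ) • r) ∂stdGaussian (Space d))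
      + (1 - p) * (∫ u, B.indicator (fun x => c * (-1 - bias p (τ * inner ℝ r x / noiseVar σ τ)))
          (√(noiseVar σ τ) • u + (-1 * τ) • r) ∂stdGaussian (Space d)) = 0 := by
  set V := noiseVar σ τ with hVdef
  have hS : 0 < √V := Real.sqrt_pos.2 hV
  have hSS : √V * √V = V := Real.mul_self_sqrt hV.le
  have hbm : Measurable (bias p) := (continuous_bias hp).measurable
  -- Shifting by `s • ω` brings both modes under one reference measure. The factor `exp (-‖ω‖²/2)`
  -- is common, and the remaining weights `p exp ⟨ω, u⟩` and `(1 - p) exp (-⟨ω, u⟩)` are those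
  -- defining `bias`, so the integrand cancels pointwise.
  set ω : Space d := (τ / √V) • r with hω
  have hH : ∀ s : ℝ, ∫ u, B.indicator (fun x => c * (s - bias p (τ * inner ℝ r x / V)))
          (√V • u + (s * τ) • r) ∂stdGaussian (Space d)
      = ∫ u, Real.exp (inner ℝ (s • ω) u - ‖s • ω‖ ^ 2 / 2) *
          B.indicator (fun x => c * (s - bias p (τ * inner ℝ r x / V))) (√V • u)
          ∂stdGaussian (Space d) := by
    intro s
    rw [← integral_stdGaussian_add (s • ω) (F := fun u =>
      B.indicator (fun x => c * (s - bias p (τ * inner ℝ r x / V))) (√V • u))]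
    · refine integral_congr_ae (ae_of_all _ fun u => ?_)
      have : √V • u + (s * τ) • r = √V • (u + s • ω) := by
        rw [hω]; match_scalars <;> field_simp
      simp only [this]
    · refine (Measurable.indicator ?_ hB).comp (by fun_prop)
      fun_prop
  rw [hH, hH, ← integral_const_mul, ← integral_const_mul, ← neg_neg (∫ _, (1 - p) * _ ∂_),
    ← integral_neg, ← sub_eq_add_neg, sub_eq_zero]
  refine integral_congr_ae (ae_of_all _ fun u => ?_)
  by_cases hu : √V • u ∈ B
  · simp only [Set.indicator_of_mem hu]
    have hT : τ * inner ℝ r (√V • u) / V = inner ℝ ω u := by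
      rw [hω, inner_smul_left, inner_smul_right]
      simp only [conj_trivial]
      field_simp
      rw [Real.sq_sqrt hV.le]
      ring
    rw [hT, one_smul, neg_one_smul, norm_neg, inner_neg_left, Real.exp_sub, Real.exp_sub]
    have h0 := bias_denom_pos hp (inner ℝ ω u)
    simp only [bias]
    field_simp
    ring
  · simp [Set.indicator_of_notMem hu]

/-- The derivative from the right of the time dilation. -/
def speed (κ : ℝ) (d : ℕ) (t : ℝ) : ℝ :=
  if t < 1 / 2 then 2 * κ / √(d : ℝ) else 2 * (1 - κ / √(d : ℝ))

lemma dilation_of_half_le (κ : ℝ) (d : ℕ) {t : ℝ} (ht : 1 / 2 ≤ t) :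
    dilation κ d t = κ / √(d : ℝ) + (1 - κ / √(d : ℝ)) * (2 * t - 1) := by
  rw [dilation]
  split_ifs with h
  · obtain rfl : t = 1 / 2 := le_antisymm h ht
    ring
  · rfl

lemma hasDerivWithinAt_dilation (κ : ℝ) (d : ℕ) (t : ℝ) :
    HasDerivWithinAt (dilation κ d) (speed κ d t) (Set.Ici t) t := by
  unfold speed
  split_ifs with h
  · have h1 : HasDerivAt (fun s : ℝ => 2 * κ * s / √(d : ℝ)) (2 * κ / √(d : ℝ)) t := by
      simpa using ((hasDerivAt_id t).const_mul (2 * κ)).div_const (√(d : ℝ))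
    refine (h1.congr_of_eventuallyEq ?_).hasDerivWithinAt
    filter_upwards [gt_mem_nhds h] with s hs
    rw [dilation, if_pos hs.le]
  · have h1 : HasDerivAt (fun s : ℝ => κ / √(d : ℝ) + (1 - κ / √(d : ℝ)) * (2 * s - 1))
        (2 * (1 - κ / √(d : ℝ))) t := by
      have := ((((hasDerivAt_id t).const_mul 2).sub_const 1).const_mul
        (1 - κ / √(d : ℝ))).const_add (κ / √(d : ℝ))
      refine this.congr_deriv (by ring)
    have ht : 1 / 2 ≤ t := not_lt.1 h
    exact h1.hasDerivWithinAt.congr (fun s hs => dilation_of_half_le κ d (ht.trans hs))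
      (dilation_of_half_le κ d ht)

lemma dilation_nonneg {κ : ℝ} (hκ : 0 < κ) {d : ℕ} (hd : κ < √(d : ℝ)) {t : ℝ} (ht : 0 ≤ t) :
    0 ≤ dilation κ d t := by
  have h0 : 0 < √(d : ℝ) := hκ.trans hd
  unfold dilation
  split_ifs with h
  · positivity
  · have : κ / √(d : ℝ) ≤ 1 := by rw [div_le_one h0]; exact hd.le
    have h2 : 0 ≤ 1 - κ / √(d : ℝ) := by linarith
    have h3 : 0 ≤ 2 * t - 1 := by linarith
    positivity

lemma dilation_lt_one {κ : ℝ} (hκ : 0 < κ) {d : ℕ} (hd : κ < √(d : ℝ)) {t : ℝ} (ht : t < 1) :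
    dilation κ d t < 1 := by
  have h0 : 0 < √(d : ℝ) := hκ.trans hd
  have h1 : κ / √(d : ℝ) < 1 := by rw [div_lt_one h0]; exact hd
  unfold dilation
  split_ifs with h
  · have : 2 * κ * t / √(d : ℝ) = (2 * t) * (κ / √(d : ℝ)) := by ring
    rw [this]
    have : 0 < κ / √(d : ℝ) := by positivity
    nlinarith
  · nlinarith

lemma interpolantDot_eq {κ : ℝ} (hκ : 0 < κ) (hd : κ < √(d : ℝ)) {t : ℝ} (ht : 0 ≤ t)
    (ht1 : t < 1) (za : Space d × Space d) :
    interpolantDot κ t za = (-(dilation κ d t * speed κ d t) / √(1 - dilation κ d t ^ 2)) • za.1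
      + speed κ d t • za.2 := by
  have h0 := dilation_nonneg hκ hd ht
  have h1 := dilation_lt_one hκ hd ht1
  have h2 : 0 < 1 - dilation κ d t ^ 2 := by nlinarith
  have hτ := hasDerivWithinAt_dilation κ d t
  have := (((hτ.pow 2).const_sub 1).sqrt h2.ne').smul_const za.1 |>.add (hτ.smul_const za.2)
  have h3 := this.derivWithin (uniqueDiffOn_Ici t t Set.self_mem_Ici)
  unfold interpolantDot
  refine Eq.trans ?_ (h3.trans ?_)
  · rfl
  · congr 2
    have : 0 < √(1 - dilation κ d t ^ 2) := Real.sqrt_pos.2 h2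
    simp only [Pi.pow_apply]
    field_simp
    ring

/-- At least one of `p` and `1 - p` is positive, so the mixture dominates a positive multiple of a
nondegenerate Gaussian. -/
lemma isOpenPosMeasure_couplingLaw {p σ : ℝ} (hσ : 0 < σ)
    (r : Space d) : (couplingLaw p σ r).IsOpenPosMeasure := by
  have hmap : ∀ s : Space d,
      ((stdGaussian (Space d)).map (fun x => s + σ • x)).IsOpenPosMeasure := fun s => by
    refine Continuous.isOpenPosMeasure_map (by fun_prop) fun x => ⟨σ⁻¹ • (x - s), ?_⟩
    rw [smul_smul, mul_inv_cancel₀ hσ.ne', one_smul]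
    abel
  have hmix : (gaussianMixture p σ r).IsOpenPosMeasure := by
    unfold gaussianMixture
    by_cases h : 0 < p
    · have := hmap r
      have h1 := Measure.isOpenPosMeasure_smul ((stdGaussian (Space d)).map (fun x => r + σ • x))
        (ENNReal.ofReal_pos.2 h).ne'
      exact (Measure.le_add_right le_rfl).isOpenPosMeasure
    · have := hmap (-r)
      have h1 := Measure.isOpenPosMeasure_smul ((stdGaussian (Space d)).map (fun x => -r + σ • x))
        (ENNReal.ofReal_pos.2 (show 0 < 1 - p by linarith)).ne'
      exact (Measure.le_add_left le_rfl).isOpenPosMeasure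
  have : IsFiniteMeasure (gaussianMixture p σ r) := by
    have h : ∀ (c : ℝ) (s : Space d), IsFiniteMeasure (ENNReal.ofReal c •
        (stdGaussian (Space d)).map (fun x => s + σ • x)) := fun c s =>
      Measure.smul_finite _ ENNReal.ofReal_ne_top
    have := h p r
    have := h (1 - p) (-r)
    unfold gaussianMixture
    infer_instance
  unfold couplingLaw
  infer_instance

lemma integrable_comp_driftField {p σ τ w α : ℝ} (hp : p ∈ Set.Icc (0 : ℝ) 1) (r : Space d)
    (s : ℝ) : Integrable (fun q : Space d × Space d =>
      driftField p σ r τ w (α • q.1 + τ • (s • r + σ • q.2)))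
      ((stdGaussian (Space d)).prod (stdGaussian (Space d))) := by
  have hI : Integrable (fun q : Space d × Space d => α • q.1 + τ • (s • r + σ • q.2))
      ((stdGaussian (Space d)).prod (stdGaussian (Space d))) :=
    (integrable_fst_stdGaussian.smul α).add
      (((integrable_const (s • r)).add (integrable_snd_stdGaussian.smul σ)).smul τ)
  have hb : Integrable (fun q : Space d × Space d =>
      bias p (τ * inner ℝ r (α • q.1 + τ • (s • r + σ • q.2)) / noiseVar σ τ))
      ((stdGaussian (Space d)).prod (stdGaussian (Space d))) := by
    refine Integrable.of_bound (C := 1) ?_ (ae_of_all _ fun u => abs_bias_le hp _)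
    exact ((continuous_bias hp).comp (by fun_prop)).aestronglyMeasurable
  unfold driftField
  have h1 := hI.smul ((σ ^ 2 - 1) * τ)
  have h2 := hb.smul_const r
  exact (h1.add h2).smul (w / noiseVar σ τ)

lemma integrable_linear {σ w A : ℝ} (r : Space d) (s : ℝ) :
    Integrable (fun q : Space d × Space d => A • q.1 + w • (s • r + σ • q.2))
      ((stdGaussian (Space d)).prod (stdGaussian (Space d))) :=
  (integrable_fst_stdGaussian.smul A).add
      (((integrable_const (s • r)).add (integrable_snd_stdGaussian.smul σ)).smul w)

lemma setIntegral_residual_couplingLaw {p σ τ w α A : ℝ} (hp : p ∈ Set.Icc (0 : ℝ) 1)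
    (hV : 0 < noiseVar σ τ) (hα : α ^ 2 = 1 - τ ^ 2) (hA : A * α = -(τ * w)) (r : Space d)
    {B : Set (Space d)} (hB : MeasurableSet B) :
    ∫ q in {q : Space d × Space d | α • q.1 + τ • q.2 ∈ B},
        (A • q.1 + w • q.2 - driftField p σ r τ w (α • q.1 + τ • q.2)) ∂couplingLaw p σ r = 0 := by
  have hbc := continuous_driftField hp σ r τ w
  have hset : MeasurableSet {q : Space d × Space d | α • q.1 + τ • q.2 ∈ B} :=
    hB.preimage (f := fun q : Space d × Space d => α • q.1 + τ • q.2) (by fun_prop)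
  have h := setIntegral_couplingLaw (σ := σ) hp (r := r)
    (f := fun q => A • q.1 + w • q.2 - driftField p σ r τ w (α • q.1 + τ • q.2)) (by fun_prop)
    (fun s => (integrable_linear r s).sub (integrable_comp_driftField hp r s)) hset
  rw [h]
  have h1 := setIntegral_residual hp hV hα hA r 1 hB
  have h2 := setIntegral_residual hp hV hα hA r (-1) hB
  simp only [Set.mem_ofPred_eq]
  rw [h1, h2, smul_smul, smul_smul, ← add_smul, integral_posterior_sign hp hV r _ hB, zero_smul]

lemma isVelocity_driftField {p σ κ : ℝ} (hp : p ∈ Set.Icc (0 : ℝ) 1) (hσ : 0 < σ) (hκ : 0 < κ)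
    (hd : κ < √(d : ℝ)) (r : Space d) {t : ℝ} (ht : 0 ≤ t) (ht1 : t < 1) :
    IsVelocity p σ κ r t (driftField p σ r (dilation κ d t) (speed κ d t)) := by
  have h0 := dilation_nonneg hκ hd ht
  have h1 := dilation_lt_one hκ hd ht1
  have h2 : 0 < 1 - dilation κ d t ^ 2 := by nlinarith
  have hV := noiseVar_pos hσ h0 h1.le
  have hdot : interpolantDot κ t = fun za : Space d × Space d => _ :=
    funext (interpolantDot_eq hκ hd ht ht1)
  set τ := dilation κ d t with hτ
  set w := speed κ d t with hw
  set α := √(1 - τ ^ 2) with hα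
  have hα0 : 0 < α := Real.sqrt_pos.2 h2
  have hIc : Continuous (interpolant κ t : Space d × Space d → Space d) := by
    unfold interpolant; fun_prop
  have hbc := continuous_driftField hp σ r τ w
  refine ⟨hbc, ?_⟩
  have hdoti : Integrable (interpolantDot κ t) (couplingLaw p σ r) := by
    rw [hdot]
    exact integrable_couplingLaw (by fun_prop) (fun s => integrable_linear r s)
  have hbI : Integrable (fun za => driftField p σ r τ w (interpolant κ t za))
      (couplingLaw p σ r) :=
    integrable_couplingLaw (hbc.comp hIc) (fun s => integrable_comp_driftField hp r s)
  refine ae_eq_condExp_of_forall_setIntegral_eq hIc.measurable.comap_le hdoti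
    (fun S _ _ => hbI.integrableOn) ?_ ?_
  · rintro S ⟨B, hB, rfl⟩ -
    rw [eq_comm, ← sub_eq_zero, ← integral_sub hdoti.integrableOn hbI.integrableOn, hdot]
    exact setIntegral_residual_couplingLaw hp hV (Real.sq_sqrt h2.le)
      (div_mul_cancel₀ _ hα0.ne') r hB
  · refine StronglyMeasurable.aestronglyMeasurable ?_
    exact hbc.stronglyMeasurable.comp_measurable (comap_measurable _)

/-- The velocity field of the probability flow in closed form. -/
theorem velocity_eq {p σ κ : ℝ} (hp : p ∈ Set.Icc (0 : ℝ) 1) (hσ : 0 < σ) (hκ : 0 < κ)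
    (hd : κ < √(d : ℝ)) (r : Space d) {t : ℝ} (ht : 0 ≤ t) (ht1 : t < 1) :
    velocity p σ κ r t = driftField p σ r (dilation κ d t) (speed κ d t) := by
  have h := isVelocity_driftField hp hσ hκ hd r ht ht1
  have hex : ∃ b, IsVelocity p σ κ r t b := ⟨_, h⟩
  have hch : IsVelocity p σ κ r t (velocity p σ κ r t) := by
    rw [velocity, dif_pos hex]; exact hex.choose_spec
  have h0 := dilation_nonneg hκ hd ht
  have h1 := dilation_lt_one hκ hd ht1
  have h2 : 0 < √(1 - dilation κ d t ^ 2) := Real.sqrt_pos.2 (by nlinarith)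
  have hIc : Continuous (interpolant κ t : Space d × Space d → Space d) := by
    unfold interpolant; fun_prop
  have := isOpenPosMeasure_couplingLaw (p := p) hσ r
  -- Full support turns almost sure equality along the interpolant into equality. Every `x` is
  -- reached by the interpolant, namely from a pair with second entry `0`.
  have heq := Measure.eq_of_ae_eq (hch.2.trans h.2.symm) (hch.1.comp hIc) (h.1.comp hIc)
  funext x
  have hx := congrFun heq ((√(1 - dilation κ d t ^ 2))⁻¹ • x, 0)
  simpa [interpolant, smul_smul, mul_inv_cancel₀ h2.ne'] using hx

/-- The default value `0` is covered too, so that `overlapLaw` is a probability measure for all `d`,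
`N` and times. -/
lemma continuous_velocity (p σ κ : ℝ) (r : Space d) (t : ℝ) :
    Continuous (velocity p σ κ r t) := by
  unfold velocity
  split_ifs with h
  · exact h.choose_spec.1
  · exact continuous_zero

end Velocity
-- Interpolated Euler schemes
section Grid

variable {F : Type*} [AddCommGroup F] [Module ℝ F]

/-- The explicit Euler scheme with step `1 / N` for a sequence of vector fields. -/
def gridEuler (N : ℕ) (f : ℕ → F → F) : ℕ → F → F
  | 0, x => x
  | k + 1, x => gridEuler N f k x + (1 / (N : ℝ)) • f k (gridEuler N f k x)

/-- The affine interpolation of the Euler scheme. -/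
def gridPath (N : ℕ) (f : ℕ → F → F) (t : ℝ) (x : F) : F :=
  gridEuler N f ⌊t * N⌋₊ x + (t - (⌊t * N⌋₊ : ℝ) / N) • f ⌊t * N⌋₊ (gridEuler N f ⌊t * N⌋₊ x)

/-- At the right end of the cell the floor has already jumped to `k + 1`, but the affine formula
gives the same value there. -/
lemma gridPath_of_mem {N : ℕ} (hN : 0 < N) (f : ℕ → F → F) (x : F) {t : ℝ} {k : ℕ}
    (h0 : (k : ℝ) / N ≤ t) (h1 : t ≤ ((k + 1 : ℕ) : ℝ) / N) :
    gridPath N f t x = gridEuler N f k x + (t - (k : ℝ) / N) • f k (gridEuler N f k x) := by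
  have hN' : (0 : ℝ) < N := by exact_mod_cast hN
  rcases h1.lt_or_eq with h | rfl
  · have : ⌊t * N⌋₊ = k := by
      rw [Nat.floor_eq_iff (mul_nonneg (le_trans (by positivity) h0) hN'.le)]
      rw [div_le_iff₀ hN'] at h0
      rw [lt_div_iff₀ hN'] at h
      exact ⟨h0, by push_cast at h; exact h⟩
    rw [gridPath, this]
  · have : ⌊((k + 1 : ℕ) : ℝ) / N * N⌋₊ = k + 1 := by
      rw [div_mul_cancel₀ _ hN'.ne', Nat.floor_natCast]
    rw [gridPath, this, sub_self, zero_smul, add_zero, gridEuler]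
    congr 2
    push_cast
    ring

lemma gridPath_grid {N : ℕ} (hN : 0 < N) (f : ℕ → F → F) (x : F) (k : ℕ) :
    gridPath N f ((k : ℝ) / N) x = gridEuler N f k x := by
  have hN' : (0 : ℝ) < N := by exact_mod_cast hN
  rw [gridPath_of_mem hN f x le_rfl (by push_cast; gcongr; linarith)]
  simp

end Grid

/-! ### Reduction to two scalar schemes -/

section Reduction

variable {d : ℕ}

/-- The rate of the component orthogonal to `r`. -/
def orthRate (σ κ : ℝ) (d : ℕ) (t : ℝ) : ℝ :=
  speed κ d t / noiseVar σ (dilation κ d t) * ((σ ^ 2 - 1) * dilation κ d t)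

/-- The vector field driving the normalized overlap `r · X / √d`. -/
def overlapDrift (p σ κ : ℝ) (d : ℕ) (t μ : ℝ) : ℝ :=
  speed κ d t / noiseVar σ (dilation κ d t) * ((σ ^ 2 - 1) * dilation κ d t * μ
    + √(d : ℝ) * bias p (dilation κ d t * √(d : ℝ) * μ / noiseVar σ (dilation κ d t)))

/-- The point with orthogonal part `A` times that of `x` and normalized overlap `B`. -/
def assemble (r : Space d) (A B : ℝ) (x : Space d) : Space d :=
  A • (x - (inner ℝ r x / (d : ℝ)) • r) + (B / √(d : ℝ)) • r

lemma inner_assemble {r : Space d} (hr : ‖r‖ ^ 2 = d) (hd : 0 < d) (A B : ℝ) (x : Space d) :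
    inner ℝ r (assemble r A B x) = √(d : ℝ) * B := by
  have hd' : (0 : ℝ) < d := by exact_mod_cast hd
  have hs : 0 < √(d : ℝ) := Real.sqrt_pos.2 hd'
  have hss : √(d : ℝ) ^ 2 = d := Real.sq_sqrt hd'.le
  rw [assemble, inner_add_right, inner_smul_right, inner_smul_right, inner_sub_right,
    inner_smul_right, real_inner_self_eq_norm_sq, hr, div_mul_cancel₀ _ hd'.ne', sub_self, mul_zero,
    zero_add]
  field_simp
  rw [hss]

lemma assemble_add_smul (r : Space d) (A B A' B' c : ℝ) (x : Space d) :
    assemble r A B x + c • assemble r A' B' x = assemble r (A + c * A') (B + c * B') x := by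
  unfold assemble
  module

/-- The drift is a multiple of `x` plus a multiple of `r` that depends on `r·x` alone; hence the two
coordinates decouple. -/
lemma driftField_assemble {p σ κ : ℝ} {r : Space d} (hr : ‖r‖ ^ 2 = d) (hd : 0 < d) (t A B : ℝ)
    (x : Space d) :
    driftField p σ r (dilation κ d t) (speed κ d t) (assemble r A B x)
      = assemble r (orthRate σ κ d t * A) (overlapDrift p σ κ d t B) x := by
  have hd' : (0 : ℝ) < d := by exact_mod_cast hd
  have hs : 0 < √(d : ℝ) := Real.sqrt_pos.2 hd'
  rw [driftField, inner_assemble hr hd, ← mul_assoc, overlapDrift, orthRate]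
  generalize bias p _ = b
  unfold assemble
  match_scalars <;> field_simp
  ring

/-- The scheme for the overlap. -/
def overlapEuler (p σ κ : ℝ) (d N : ℕ) : ℕ → ℝ → ℝ :=
  gridEuler N fun k => overlapDrift p σ κ d ((k : ℝ) / N)

/-- The interpolated scheme for the overlap. -/
def overlapPath (p σ κ : ℝ) (d N : ℕ) : ℝ → ℝ → ℝ :=
  gridPath N fun k => overlapDrift p σ κ d ((k : ℝ) / N)

/-- The interpolated scheme for the scale of the orthogonal component. -/
def orthPath (σ κ : ℝ) (d N : ℕ) (t : ℝ) : ℝ :=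
  gridPath N (fun k y => orthRate σ κ d ((k : ℝ) / N) * y) t 1

variable {p σ κ : ℝ} (hp : p ∈ Set.Icc (0 : ℝ) 1) (hσ : 0 < σ) (hκ : 0 < κ) (hd : κ < √(d : ℝ))
  {r : Space d} (hr : ‖r‖ ^ 2 = d) {N : ℕ} (hN : 0 < N)

lemma dim_pos {κ : ℝ} (hκ : 0 < κ) (hd : κ < √(d : ℝ)) : 0 < d := by
  rcases Nat.eq_zero_or_pos d with rfl | h
  · simp at hd; linarith
  · exact h

include hp hσ hκ hd hr hN

lemma velocity_assemble {k : ℕ} (hk : k < N) (A B : ℝ) (x : Space d) :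
    velocity p σ κ r ((k : ℝ) / N) (assemble r A B x)
      = assemble r (orthRate σ κ d ((k : ℝ) / N) * A) (overlapDrift p σ κ d ((k : ℝ) / N) B) x := by
  have hN' : (0 : ℝ) < N := by exact_mod_cast hN
  rw [velocity_eq hp hσ hκ hd r (by positivity)
    (by rw [div_lt_one hN']; exact_mod_cast hk), driftField_assemble hr (dim_pos hκ hd)]

lemma euler_eq_assemble (x : Space d) {k : ℕ} (hk : k ≤ N) :
    euler p σ κ r N k x = assemble r
      (gridEuler N (fun k y => orthRate σ κ d ((k : ℝ) / N) * y) k 1)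
      (overlapEuler p σ κ d N k (inner ℝ r x / √(d : ℝ))) x := by
  induction k with
  | zero =>
    have hd' : (0 : ℝ) < d := by exact_mod_cast dim_pos hκ hd
    simp only [euler, overlapEuler, gridEuler, assemble, div_div, Real.mul_self_sqrt hd'.le]
    module
  | succ k ih =>
    rw [euler, ih (by omega), velocity_assemble hp hσ hκ hd hr hN (by omega), assemble_add_smul]
    rfl

lemma flow_eq_assemble (x : Space d) {t : ℝ} (ht : t ∈ Set.Icc (0 : ℝ) 1) :
    flow p σ κ r N t x = assemble r (orthPath σ κ d N t)
      (overlapPath p σ κ d N t (inner ℝ r x / √(d : ℝ))) x := by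
  have hN' : (0 : ℝ) < N := by exact_mod_cast hN
  have hle : ⌊t * N⌋₊ ≤ N := Nat.floor_le_of_le (by nlinarith [ht.2])
  rw [flow, euler_eq_assemble hp hσ hκ hd hr hN x hle]
  rcases hle.lt_or_eq with h | h
  · rw [velocity_assemble hp hσ hκ hd hr hN h, assemble_add_smul]
    rfl
  -- Index `N` occurs only at `t = 1`, where the interpolation weight is zero, so the velocity at
  -- time `1` plays no role.
  · have : (N : ℝ) ≤ t * N := by
      have := Nat.floor_le (mul_nonneg ht.1 hN'.le)
      rwa [h] at this
    have ht1 : t = 1 := le_antisymm ht.2 (by nlinarith)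
    have : t - (N : ℝ) / N = 0 := by rw [div_self hN'.ne', ht1, sub_self]
    simp only [orthPath, overlapPath, gridPath, h, this, zero_smul, add_zero]
    rfl

lemma inner_flow_div_sqrt (x : Space d) {t : ℝ} (ht : t ∈ Set.Icc (0 : ℝ) 1) :
    inner ℝ r (flow p σ κ r N t x) / √(d : ℝ)
      = overlapPath p σ κ d N t (inner ℝ r x / √(d : ℝ)) := by
  have hd0 := dim_pos hκ hd
  have hs : 0 < √(d : ℝ) := Real.sqrt_pos.2 (by exact_mod_cast hd0)
  rw [flow_eq_assemble hp hσ hκ hd hr hN x ht, inner_assemble hr hd0, mul_div_cancel_left₀ _ hs.ne']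

lemma flow_sub_proj (x : Space d) {t : ℝ} (ht : t ∈ Set.Icc (0 : ℝ) 1) :
    flow p σ κ r N t x - (inner ℝ r (flow p σ κ r N t x) / (d : ℝ)) • r
      = orthPath σ κ d N t • (x - (inner ℝ r x / (d : ℝ)) • r) := by
  have hd0 := dim_pos hκ hd
  have hd' : (0 : ℝ) < d := by exact_mod_cast hd0
  have hs : 0 < √(d : ℝ) := Real.sqrt_pos.2 hd'
  rw [flow_eq_assemble hp hσ hκ hd hr hN x ht, inner_assemble hr hd0, assemble]
  have : √(d : ℝ) * overlapPath p σ κ d N t (inner ℝ r x / √(d : ℝ)) / d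
      = overlapPath p σ κ d N t (inner ℝ r x / √(d : ℝ)) / √(d : ℝ) := by
    rw [div_eq_div_iff hd'.ne' hs.ne', mul_right_comm, Real.mul_self_sqrt hd'.le, mul_comm]
  rw [this, add_sub_cancel_right]

omit hp hσ hκ hd hr hN

/-- Both characteristic functions at `ξ` are `exp (-‖Pξ‖²/2)`, with `P` the orthogonal projection
onto `r^⊥`. -/
lemma map_proj_stdGaussian (hd : 0 < d) (hr : ‖r‖ ^ 2 = d) :
    (stdGaussian (Space d)).map (fun x => x - (inner ℝ r x / (d : ℝ)) • r)
      = (stdGaussian ((Submodule.span ℝ {r})ᗮ : Submodule ℝ (Space d))).map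
        (fun v : ((Submodule.span ℝ {r})ᗮ : Submodule ℝ (Space d)) => (v : Space d)) := by
  have hd' : (0 : ℝ) < d := by exact_mod_cast hd
  have := Measure.isProbabilityMeasure_map (μ := stdGaussian (Space d))
    (f := fun x => x - (inner ℝ r x / (d : ℝ)) • r) (by fun_prop)
  have := Measure.isProbabilityMeasure_map
    (μ := stdGaussian ((Submodule.span ℝ {r})ᗮ : Submodule ℝ (Space d)))
    (f := fun v : ((Submodule.span ℝ {r})ᗮ : Submodule ℝ (Space d)) => (v : Space d)) (by fun_prop)
  apply Measure.ext_of_charFun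
  ext ξ
  set K := (Submodule.span ℝ {r})ᗮ
  have hproj : (K.orthogonalProjectionOnto ξ : Space d) = ξ - (inner ℝ r ξ / (d : ℝ)) • r := by
    refine Submodule.eq_starProjection_of_mem_of_inner_eq_zero (K := K) ?_ ?_
    · rw [Submodule.mem_orthogonal_singleton_iff_inner_right, inner_sub_right, inner_smul_right,
        real_inner_self_eq_norm_sq, hr, div_mul_cancel₀ _ hd'.ne', sub_self]
    · intro w hw
      rw [Submodule.mem_orthogonal_singleton_iff_inner_right] at hw
      rw [sub_sub_cancel, inner_smul_left, hw, mul_zero]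
  have h1 : charFun ((stdGaussian (Space d)).map (fun x => x - (inner ℝ r x / (d : ℝ)) • r)) ξ
      = charFun (stdGaussian (Space d)) (ξ - (inner ℝ r ξ / (d : ℝ)) • r) := by
    rw [charFun_apply, charFun_apply, integral_map (by fun_prop) (by fun_prop)]
    refine integral_congr_ae (ae_of_all _ fun x => ?_)
    dsimp only
    congr 3
    simp only [inner_sub_left, inner_sub_right, inner_smul_left, inner_smul_right,
      real_inner_comm x r, conj_trivial]
    ring
  have h2 : charFun ((stdGaussian K).map (fun v : K => (v : Space d))) ξ
      = charFun (stdGaussian K) (K.orthogonalProjectionOnto ξ) := by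
    rw [charFun_apply, charFun_apply, integral_map (by fun_prop) (by fun_prop)]
    refine integral_congr_ae (ae_of_all _ fun x => ?_)
    dsimp only
    congr 3
    rw [Submodule.inner_orthogonalProjectionOnto_eq_of_mem_left]
  rw [h1, h2, charFun_stdGaussian, charFun_stdGaussian, ← hproj, Submodule.coe_norm]

-- By symmetry of the Gaussian law the sign of `orthPath` does not matter.
include hp hσ hκ hd hr hN in
theorem orthLaw_eq {t : ℝ} (ht : t ∈ Set.Icc (0 : ℝ) 1) :
    orthLaw p σ κ r N t = orthGaussian r |orthPath σ κ d N t| := by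
  set a := orthPath σ κ d N t with ha
  set K := (Submodule.span ℝ {r})ᗮ with hK
  have h1 : orthLaw p σ κ r N t = (stdGaussian K).map (fun v : K => a • (v : Space d)) := by
    have : (fun v : K => a • (v : Space d)) = (fun y : Space d => a • y) ∘
      (fun v : K => (v : Space d)) := rfl
    rw [this, ← Measure.map_map (by fun_prop) (by fun_prop), hK,
      ← map_proj_stdGaussian (dim_pos hκ hd) hr, Measure.map_map (by fun_prop) (by fun_prop),
      orthLaw]
    congr 1
    ext1 x
    exact flow_sub_proj hp hσ hκ hd hr hN x ht
  rw [h1, orthGaussian]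
  rcases abs_choice a with h | h
  · rw [h]
  · rw [h]
    conv_rhs => rw [← stdGaussian_map (LinearIsometryEquiv.neg ℝ (E := K)),
      Measure.map_map (by fun_prop) (by fun_prop)]
    congr 1
    ext1 v
    simp

lemma map_overlap_stdGaussian (hd : 0 < d) (hr : ‖r‖ ^ 2 = d) :
    (stdGaussian (Space d)).map (fun x => inner ℝ r x / √(d : ℝ)) = gaussianReal 0 1 := by
  have hd' : (0 : ℝ) < d := by exact_mod_cast hd
  have := Measure.isProbabilityMeasure_map (μ := stdGaussian (Space d))
    (f := fun x => inner ℝ r x / √(d : ℝ)) (by fun_prop)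
  apply Measure.ext_of_charFun
  ext ξ
  have h1 : charFun ((stdGaussian (Space d)).map (fun x => inner ℝ r x / √(d : ℝ))) ξ
      = charFun (stdGaussian (Space d)) ((ξ / √(d : ℝ)) • r) := by
    rw [charFun_apply_real, charFun_apply, integral_map (by fun_prop) (by fun_prop)]
    refine integral_congr_ae (ae_of_all _ fun x => ?_)
    dsimp only
    congr 2
    rw [inner_smul_right, real_inner_comm]
    push_cast
    ring
  rw [h1, charFun_stdGaussian, charFun_gaussianReal]
  congr 1
  rw [← Complex.ofReal_pow, norm_smul, mul_pow, hr, Real.norm_eq_abs, sq_abs, div_pow,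
    Real.sq_sqrt hd'.le, div_mul_cancel₀ _ hd'.ne']
  push_cast
  ring_nf

lemma continuous_overlapDrift (hp : p ∈ Set.Icc (0 : ℝ) 1) (σ κ : ℝ) (d : ℕ) (t : ℝ) :
    Continuous (overlapDrift p σ κ d t) := by
  unfold overlapDrift
  have := (continuous_bias hp).comp (g := bias p) (f := fun μ : ℝ => dilation κ d t * √(d : ℝ) * μ /
    noiseVar σ (dilation κ d t)) (by fun_prop)
  simp only [Function.comp_def] at this
  fun_prop

lemma continuous_gridEuler {N : ℕ} {f : ℕ → ℝ → ℝ} (hf : ∀ k, Continuous (f k)) (k : ℕ) :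
    Continuous (gridEuler N f k) := by
  induction k with
  | zero => exact continuous_id
  | succ k ih =>
    exact ih.add (((hf k).comp ih).const_smul (1 / (N : ℝ)))

lemma continuous_gridPath {N : ℕ} {f : ℕ → ℝ → ℝ} (hf : ∀ k, Continuous (f k)) (t : ℝ) :
    Continuous (gridPath N f t) :=
  (continuous_gridEuler hf _).add
    (((hf _).comp (continuous_gridEuler hf _)).const_smul (t - (⌊t * N⌋₊ : ℝ) / N))

-- All `d` and `N` are coupled through the same Gaussian `ω`. The first phase uses `c = 1`, the
-- second `c = √d`.
include hp hσ hκ hd hr hN in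
theorem overlapLaw_eq (c : ℝ) {m : ℕ} {T : Fin m → ℝ} (hT : ∀ i, T i ∈ Set.Icc (0 : ℝ) 1) :
    overlapLaw p σ κ r N (√(d : ℝ) * c) T
      = (gaussianReal 0 1).map fun ω i => overlapPath p σ κ d N (T i) ω / c := by
  have hc : ∀ t, Continuous (overlapPath p σ κ d N t) := fun t =>
    continuous_gridPath (fun k => continuous_overlapDrift hp σ κ d _) t
  rw [← map_overlap_stdGaussian (dim_pos hκ hd) hr, Measure.map_map (by fun_prop) (by fun_prop),
    overlapLaw]
  congr 1
  ext x i
  rw [← div_div, inner_flow_div_sqrt hp hσ hκ hd hr hN x (hT i)]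
  rfl

lemma continuous_euler (p σ κ : ℝ) (r : Space d) (N k : ℕ) : Continuous (euler p σ κ r N k) := by
  induction k with
  | zero => exact continuous_id
  | succ k ih =>
    exact ih.add (((continuous_velocity p σ κ r _).comp ih).const_smul (1 / (N : ℝ)))

lemma isProbabilityMeasure_overlapLaw (p σ κ : ℝ) (r : Space d) (N : ℕ) (c : ℝ) {m : ℕ}
    (T : Fin m → ℝ) : IsProbabilityMeasure (overlapLaw p σ κ r N c T) := by
  have hc : ∀ t, Continuous (flow p σ κ r N t) := fun t =>
    (continuous_euler p σ κ r N _).add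
      (((continuous_velocity p σ κ r _).comp (continuous_euler p σ κ r N _)).const_smul (t - (⌊t * N⌋₊ : ℝ) / N))
  exact Measure.isProbabilityMeasure_map (by fun_prop)

end Reduction
-- Stability and rescaling of grid schemes
section GridLimits

variable {ι : Type*} {l : Filter ι} {N : ℕ} {f : ι → ℕ → ℝ → ℝ} {g : ℕ → ℝ → ℝ} {x : ι → ℝ} {y : ℝ}
  {K : ℕ}

/-- If the vector fields converge along the scheme, then the scheme converges. -/
lemma tendsto_gridEuler (hx : Tendsto x l (𝓝 y))
    (hf : ∀ k < K, Tendsto (fun i => gridEuler N (f i) k (x i)) l (𝓝 (gridEuler N g k y)) →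
      Tendsto (fun i => f i k (gridEuler N (f i) k (x i))) l (𝓝 (g k (gridEuler N g k y))))
    {k : ℕ} (hk : k ≤ K) :
    Tendsto (fun i => gridEuler N (f i) k (x i)) l (𝓝 (gridEuler N g k y)) := by
  induction k with
  | zero => exact hx
  | succ k ih =>
    have h := ih (by omega)
    exact h.add ((hf k (by omega) h).const_smul (1 / (N : ℝ)))

lemma tendsto_gridPath (hN : 0 < N) (hx : Tendsto x l (𝓝 y))
    (hf : ∀ k < K, Tendsto (fun i => gridEuler N (f i) k (x i)) l (𝓝 (gridEuler N g k y)) →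
      Tendsto (fun i => f i k (gridEuler N (f i) k (x i))) l (𝓝 (g k (gridEuler N g k y))))
    {t : ℝ} (ht0 : 0 ≤ t) (ht : t ≤ (K : ℝ) / N) :
    Tendsto (fun i => gridPath N (f i) t (x i)) l (𝓝 (gridPath N g t y)) := by
  have hN' : (0 : ℝ) < N := by exact_mod_cast hN
  rcases ht.lt_or_eq with h | rfl
  · have hk : ⌊t * N⌋₊ < K := by
      rw [Nat.floor_lt (by positivity)]
      rwa [lt_div_iff₀ hN'] at h
    have h1 := tendsto_gridEuler hx hf hk.le
    exact h1.add ((hf _ hk h1).const_smul (t - (⌊t * N⌋₊ : ℝ) / N))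
  · simp only [gridPath_grid hN]
    exact tendsto_gridEuler hx hf le_rfl

/-- With `c = √d` this passes from the scale `r·X/√d` to the scale `r·X/d`. -/
lemma gridEuler_div (f : ℕ → ℝ → ℝ) {c : ℝ} (hc : c ≠ 0) (x : ℝ) (k : ℕ) :
    gridEuler N f k x / c = gridEuler N (fun k y => f k (c * y) / c) k (x / c) := by
  induction k with
  | zero => rfl
  | succ k ih =>
    simp only [gridEuler, ← ih, mul_div_cancel₀ _ hc, smul_eq_mul]
    ring

lemma gridPath_div (f : ℕ → ℝ → ℝ) {c : ℝ} (hc : c ≠ 0) (x t : ℝ) :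
    gridPath N f t x / c = gridPath N (fun k y => f k (c * y) / c) t (x / c) := by
  simp only [gridPath, ← gridEuler_div f hc, mul_div_cancel₀ _ hc, smul_eq_mul]
  ring

end GridLimits

/-! ### Convergence of the Euler method -/

section EulerConvergence

variable {f : ℝ → ℝ → ℝ} {y : ℝ → ℝ} {b K L : ℝ}

/-- The local error is quadratic as soon as the derivative is Lipschitz along the solution; no
second derivative is needed. -/
lemma abs_taylor_le (hL : 0 ≤ L)
    (hy : ∀ t ∈ Set.Icc 0 b, HasDerivWithinAt y (f t (y t)) (Set.Icc 0 b) t)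
    (hfL : ∀ s ∈ Set.Icc 0 b, ∀ t ∈ Set.Icc 0 b, |f s (y s) - f t (y t)| ≤ L * |s - t|)
    {s t : ℝ} (hs : 0 ≤ s) (hst : s ≤ t) (ht : t ≤ b) :
    |y t - y s - (t - s) * f s (y s)| ≤ L * (t - s) ^ 2 := by
  have hsub : Set.Icc s t ⊆ Set.Icc 0 b := Set.Icc_subset_Icc hs ht
  have := Convex.norm_image_sub_le_of_norm_hasDerivWithin_le (𝕜 := ℝ)
    (f := fun u => y u - u * f s (y s)) (f' := fun u => f u (y u) - f s (y s))
    (C := L * (t - s)) (s := Set.Icc s t) (x := s) (y := t) (fun u hu => ?_) (fun u hu => ?_)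
    (convex_Icc s t) (Set.left_mem_Icc.2 hst) (Set.right_mem_Icc.2 hst)
  · rw [Real.norm_eq_abs, Real.norm_eq_abs, abs_of_nonneg (sub_nonneg.2 hst)] at this
    calc _ = |y t - t * f s (y s) - (y s - s * f s (y s))| := by ring_nf
      _ ≤ _ := this
      _ = _ := by ring
  · have h1 := (hy u (hsub hu)).mono hsub
    exact (h1.sub ((hasDerivWithinAt_id u (Set.Icc s t)).mul_const (f s (y s)))).congr_deriv
      (by ring)
  · refine (hfL u (hsub hu) s (hsub (Set.left_mem_Icc.2 hst))).trans ?_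
    rw [abs_of_nonneg (sub_nonneg.2 hu.1)]
    have := hu.2
    gcongr

/-- The amplification `1 + K (t - s)` is absorbed by the exponential and the local error by the
growth of `L t δ`. Since `t` is any point of the cell, the same bound serves the induction and the
interpolation. -/
lemma euler_step_error (hK : 0 ≤ K) (hL : 0 ≤ L)
    (hy : ∀ t ∈ Set.Icc 0 b, HasDerivWithinAt y (f t (y t)) (Set.Icc 0 b) t)
    (hfK : ∀ t ∈ Set.Icc 0 b, ∀ u v, |f t u - f t v| ≤ K * |u - v|)
    (hfL : ∀ s ∈ Set.Icc 0 b, ∀ t ∈ Set.Icc 0 b, |f s (y s) - f t (y t)| ≤ L * |s - t|)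
    {s t δ u : ℝ} (hs : 0 ≤ s) (hst : s ≤ t) (htδ : t ≤ s + δ) (ht : t ≤ b)
    (hu : |u - y s| ≤ Real.exp (K * s) * (L * s * δ)) :
    |u + (t - s) * f s u - y t| ≤ Real.exp (K * t) * (L * t * δ) := by
  have h1 := abs_taylor_le hL hy hfL hs hst ht
  have h2 := hfK s ⟨hs, hst.trans ht⟩ u (y s)
  have hh : 0 ≤ t - s := sub_nonneg.2 hst
  have hδ : 0 ≤ δ := by linarith
  have e1 : 1 ≤ Real.exp (K * t) := Real.one_le_exp (by have := hs.trans hst; positivity)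
  have e2 : Real.exp (K * s) * (1 + K * (t - s)) ≤ Real.exp (K * t) := by
    calc _ ≤ Real.exp (K * s) * Real.exp (K * (t - s)) := by
          gcongr; linarith [Real.add_one_le_exp (K * (t - s))]
      _ = _ := by rw [← Real.exp_add]; ring_nf
  calc |u + (t - s) * f s u - y t|
      = |(u - y s) + (t - s) * (f s u - f s (y s)) - (y t - y s - (t - s) * f s (y s))| := by
        ring_nf
    _ ≤ |u - y s| + (t - s) * |f s u - f s (y s)| + |y t - y s - (t - s) * f s (y s)| := by
        refine (abs_sub _ _).trans ?_
        gcongr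
        refine (abs_add_le _ _).trans ?_
        rw [abs_mul, abs_of_nonneg hh]
    _ ≤ |u - y s| + (t - s) * (K * |u - y s|) + L * (t - s) ^ 2 := by gcongr
    _ = |u - y s| * (1 + K * (t - s)) + L * ((t - s) * (t - s)) := by ring
    _ ≤ Real.exp (K * s) * (L * s * δ) * (1 + K * (t - s)) + L * ((t - s) * δ) := by
        gcongr
        linarith
    _ = (Real.exp (K * s) * (1 + K * (t - s))) * (L * s * δ) + 1 * (L * (t - s) * δ) := by ring
    _ ≤ Real.exp (K * t) * (L * s * δ) + Real.exp (K * t) * (L * (t - s) * δ) := by gcongr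
    _ = _ := by ring

/-- The global error of the interpolated Euler scheme. -/
theorem gridPath_error (hK : 0 ≤ K) (hL : 0 ≤ L)
    (hy : ∀ t ∈ Set.Icc 0 b, HasDerivWithinAt y (f t (y t)) (Set.Icc 0 b) t)
    (hfK : ∀ t ∈ Set.Icc 0 b, ∀ u v, |f t u - f t v| ≤ K * |u - v|)
    (hfL : ∀ s ∈ Set.Icc 0 b, ∀ t ∈ Set.Icc 0 b, |f s (y s) - f t (y t)| ≤ L * |s - t|)
    {N : ℕ} (hN : 0 < N) {t : ℝ} (ht : t ∈ Set.Icc 0 b) :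
    |gridPath N (fun k => f ((k : ℝ) / N)) t (y 0) - y t|
      ≤ Real.exp (K * t) * (L * t * (1 / (N : ℝ))) := by
  have hN' : (0 : ℝ) < N := by exact_mod_cast hN
  have key : ∀ k : ℕ, (k : ℝ) / N ≤ b →
      |gridEuler N (fun k => f ((k : ℝ) / N)) k (y 0) - y ((k : ℝ) / N)|
        ≤ Real.exp (K * ((k : ℝ) / N)) * (L * ((k : ℝ) / N) * (1 / (N : ℝ))) := by
    intro k
    induction k with
    | zero => intro _; simp [gridEuler]
    | succ k ih =>
      intro hk
      have hlt : (k : ℝ) / N ≤ ((k + 1 : ℕ) : ℝ) / N := by push_cast; gcongr; linarith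
      have hstep : ((k + 1 : ℕ) : ℝ) / N - (k : ℝ) / N = 1 / (N : ℝ) := by push_cast; ring
      have := euler_step_error hK hL hy hfK hfL (by positivity) hlt (by linarith) hk
        (ih (hlt.trans hk))
      rw [hstep] at this
      exact this
  have hfl : (⌊t * N⌋₊ : ℝ) ≤ t * N := Nat.floor_le (mul_nonneg ht.1 hN'.le)
  have hfl' := Nat.lt_floor_add_one (t * N)
  have hle : (⌊t * N⌋₊ : ℝ) / N ≤ t := by rwa [div_le_iff₀ hN']
  refine euler_step_error hK hL hy hfK hfL (by positivity) hle ?_ ht.2 (key _ (hle.trans ht.2))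
  rw [← add_div, le_div_iff₀ hN']
  exact hfl'.le

theorem tendsto_gridPath_ode (hK : 0 ≤ K) (hL : 0 ≤ L)
    (hy : ∀ t ∈ Set.Icc 0 b, HasDerivWithinAt y (f t (y t)) (Set.Icc 0 b) t)
    (hfK : ∀ t ∈ Set.Icc 0 b, ∀ u v, |f t u - f t v| ≤ K * |u - v|)
    (hfL : ∀ s ∈ Set.Icc 0 b, ∀ t ∈ Set.Icc 0 b, |f s (y s) - f t (y t)| ≤ L * |s - t|)
    {t : ℝ} (ht : t ∈ Set.Icc 0 b) :
    Tendsto (fun N : ℕ => gridPath N (fun k => f ((k : ℝ) / N)) t (y 0)) atTop (𝓝 (y t)) := by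
  rw [tendsto_iff_norm_sub_tendsto_zero]
  refine squeeze_zero' (Eventually.of_forall fun _ => norm_nonneg _)
    ((eventually_gt_atTop 0).mono fun N hN => gridPath_error hK hL hy hfK hfL hN ht) ?_
  have := (tendsto_one_div_atTop_nhds_zero_nat (𝕜 := ℝ)).const_mul (L * t)
    |>.const_mul (Real.exp (K * t))
  simpa using this

end EulerConvergence

/-! ### From almost sure limits to limits in law -/

section InLaw

variable {Ω F : Type*} [MeasurableSpace Ω] [TopologicalSpace F]
  [TopologicalSpace.PseudoMetrizableSpace F] [MeasurableSpace F] [BorelSpace F]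

/-- Iterated almost sure convergence implies iterated convergence in law. -/
theorem iteratedLimitInLaw_of_ae {P : Measure Ω} [IsProbabilityMeasure P]
    {u : ℕ → ℕ → Measure F} (hu : ∀ n d, IsProbabilityMeasure (u n d))
    {Y : ℕ → ℕ → Ω → F} {Z : ℕ → Ω → F} {L : Ω → F}
    (hY : ∀ n d, AEMeasurable (Y n d) P)
    (huY : ∀ᶠ n in atTop, ∀ᶠ d in atTop, u n d = P.map (Y n d))
    (hYZ : ∀ᶠ n in atTop, ∀ᵐ ω ∂P, Tendsto (fun d => Y n d ω) atTop (𝓝 (Z n ω)))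
    (hZ : ∀ n, AEMeasurable (Z n) P)
    (hZL : ∀ᵐ ω ∂P, Tendsto (fun n => Z n ω) atTop (𝓝 (L ω))) :
    IteratedLimitInLaw u (P.map L) := by
  have hL : AEMeasurable L P := aemeasurable_of_tendsto_metrizable_ae atTop hZ hZL
  refine ⟨fun n d => ⟨u n d, hu n d⟩, ⟨P.map L, Measure.isProbabilityMeasure_map hL⟩,
    fun n d => rfl, rfl, fun n => ⟨P.map (Z n), Measure.isProbabilityMeasure_map (hZ n)⟩, ?_,
    (tendstoInDistribution_of_ae_tendsto hZ hL hZL).tendsto⟩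
  filter_upwards [huY, hYZ] with n h1 h2
  refine (tendstoInDistribution_of_ae_tendsto (hY n) (hZ n) h2).tendsto.congr' ?_
  filter_upwards [h1] with d hd
  exact Subtype.ext hd.symm

end InLaw

/-! ### The normal distribution function -/

section GaussianCDF

lemma hasDerivAt_cdf_gaussianReal (x : ℝ) :
    HasDerivAt (cdf (gaussianReal 0 1)) (gaussianPDFReal 0 1 x) x := by
  have hc : Continuous (gaussianPDFReal 0 1) := by
    unfold gaussianPDFReal; fun_prop
  have hi := integrable_gaussianPDFReal 0 1
  have h : ∀ y, cdf (gaussianReal 0 1) y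
      = (∫ u in (0 : ℝ)..y, gaussianPDFReal 0 1 u) + cdf (gaussianReal 0 1) 0 := by
    have h0 : ∀ y, cdf (gaussianReal 0 1) y = ∫ u in Set.Iic y, gaussianPDFReal 0 1 u := fun y => by
      rw [cdf_eq_real, Measure.real, gaussianReal_apply_eq_integral _ one_ne_zero,
        ENNReal.toReal_ofReal (integral_nonneg fun u => gaussianPDFReal_nonneg _ _ _)]
    intro y
    rw [h0, h0, ← intervalIntegral.integral_Iic_sub_Iic hi.integrableOn hi.integrableOn]
    ring
  have h1 := (intervalIntegral.integral_hasDerivAt_right (hi.intervalIntegrable (a := 0) (b := x))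
    hc.stronglyMeasurable.stronglyMeasurableAtFilter hc.continuousAt).add_const
    (cdf (gaussianReal 0 1) 0)
  exact h1.congr_of_eventuallyEq (Eventually.of_forall h)

lemma strictMono_cdf_gaussianReal : StrictMono (cdf (gaussianReal 0 1)) :=
  strictMono_of_hasDerivAt_pos hasDerivAt_cdf_gaussianReal
    fun _ => gaussianPDFReal_pos _ _ _ one_ne_zero

lemma continuous_cdf_gaussianReal : Continuous (cdf (gaussianReal 0 1)) :=
  continuous_iff_continuousAt.2 fun x => (hasDerivAt_cdf_gaussianReal x).continuousAt

lemma gaussianReal_Iic (m c : ℝ) :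
    gaussianReal m 1 (Set.Iic c) = ENNReal.ofReal (cdf (gaussianReal 0 1) (c - m)) := by
  rw [ofReal_cdf]
  have := gaussianReal_map_add_const (μ := 0) (v := 1) m
  rw [zero_add] at this
  rw [← this, Measure.map_apply (by fun_prop) measurableSet_Iic]
  congr 1
  ext x
  simp [le_sub_iff_add_le]

end GaussianCDF

/-- The limiting vector field of the overlap in the first phase. -/
def firstDrift (p κ t x : ℝ) : ℝ := 2 * κ * bias p (2 * κ * t * x)

/-! ### The limiting equation of the first phase -/

section FirstDrift

variable {p κ : ℝ}

lemma abs_firstDrift_le (hp : p ∈ Set.Icc (0 : ℝ) 1) (hκ : 0 < κ) (t x : ℝ) :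
    |firstDrift p κ t x| ≤ 2 * κ := by
  rw [firstDrift, abs_mul, abs_of_pos (by positivity : 0 < 2 * κ)]
  have := abs_bias_le hp (2 * κ * t * x)
  nlinarith

lemma firstDrift_lipschitz (hp : p ∈ Set.Icc (0 : ℝ) 1) (hκ : 0 < κ) {t : ℝ}
    (ht : t ∈ Set.Icc (0 : ℝ) (1 / 2)) (x y : ℝ) :
    |firstDrift p κ t x - firstDrift p κ t y| ≤ 2 * κ ^ 2 * |x - y| := by
  rw [firstDrift, firstDrift, ← mul_sub, abs_mul, abs_of_pos (by positivity : 0 < 2 * κ)]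
  have h := abs_bias_sub_le hp (2 * κ * t * x) (2 * κ * t * y)
  have h' : |2 * κ * t * x - 2 * κ * t * y| = 2 * κ * t * |x - y| := by
    rw [← mul_sub, abs_mul, abs_of_nonneg (by have := ht.1; positivity)]
  rw [h'] at h
  calc _ ≤ 2 * κ * (2 * κ * t * |x - y|) := by gcongr
    _ ≤ 2 * κ * (2 * κ * (1 / 2) * |x - y|) := by have := ht.2; gcongr
    _ = _ := by ring

lemma exists_firstDrift_solution (hp : p ∈ Set.Icc (0 : ℝ) 1) (hκ : 0 < κ) (x : ℝ) :
    ∃ y : ℝ → ℝ, y 0 = x ∧ ∀ t ∈ Set.Icc (0 : ℝ) (1 / 2),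
      HasDerivWithinAt y (firstDrift p κ t (y t)) (Set.Icc 0 (1 / 2)) t := by
  -- The field is bounded by `2κ`, so on an interval of length `1/2` the solution stays within
  -- distance `κ` of its start.
  have hPL : IsPicardLindelof (firstDrift p κ) (tmin := 0) (tmax := 1 / 2)
      ⟨0, by norm_num⟩ x ⟨κ, hκ.le⟩ 0 ⟨2 * κ, by positivity⟩ ⟨2 * κ ^ 2, by positivity⟩ := by
    refine ⟨fun t ht => ?_, fun y _ => ?_, fun t _ y _ => abs_firstDrift_le hp hκ t y, ?_⟩
    · refine LipschitzWith.lipschitzOnWith (LipschitzWith.of_dist_le_mul fun u v => ?_)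
      exact firstDrift_lipschitz hp hκ ht u v
    · unfold firstDrift
      have := (continuous_bias hp).comp (g := bias p) (f := fun t : ℝ => 2 * κ * t * y)
        (by fun_prop)
      exact (continuous_const.mul this).continuousOn
    · simp only [sub_zero, sub_self, NNReal.coe_zero]
      rw [max_eq_left (by norm_num)]
      show 2 * κ * (1 / 2) ≤ κ
      linarith
  exact hPL.exists_eq_forall_mem_Icc_hasDerivWithinAt₀

lemma abs_solution_sub_le (hp : p ∈ Set.Icc (0 : ℝ) 1) (hκ : 0 < κ) {y : ℝ → ℝ}
    (hy : ∀ t ∈ Set.Icc (0 : ℝ) (1 / 2),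
      HasDerivWithinAt y (firstDrift p κ t (y t)) (Set.Icc 0 (1 / 2)) t) {s t : ℝ}
    (hs : s ∈ Set.Icc (0 : ℝ) (1 / 2)) (ht : t ∈ Set.Icc (0 : ℝ) (1 / 2)) :
    |y s - y t| ≤ 2 * κ * |s - t| :=
  (convex_Icc _ _).norm_image_sub_le_of_norm_hasDerivWithin_le hy
    (fun u _ => abs_firstDrift_le hp hκ u (y u)) ht hs

/-- Time multiplies the position inside `bias`, so the time regularity is controlled along a
solution, where the position is at most `|y 0| + κ`; the constant depends on the starting point. -/
lemma abs_firstDrift_solution_sub_le (hp : p ∈ Set.Icc (0 : ℝ) 1) (hκ : 0 < κ) {y : ℝ → ℝ}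
    (hy : ∀ t ∈ Set.Icc (0 : ℝ) (1 / 2),
      HasDerivWithinAt y (firstDrift p κ t (y t)) (Set.Icc 0 (1 / 2)) t) {s t : ℝ}
    (hs : s ∈ Set.Icc (0 : ℝ) (1 / 2)) (ht : t ∈ Set.Icc (0 : ℝ) (1 / 2)) :
    |firstDrift p κ s (y s) - firstDrift p κ t (y t)|
      ≤ 4 * κ ^ 2 * (|y 0| + 2 * κ) * |s - t| := by
  have h0 : (0 : ℝ) ∈ Set.Icc (0 : ℝ) (1 / 2) := by norm_num
  have h1 := abs_solution_sub_le hp hκ hy hs ht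
  have h2 := abs_solution_sub_le hp hκ hy hs h0
  rw [sub_zero, abs_of_nonneg hs.1] at h2
  have h3 : |y s| ≤ |y 0| + κ := by
    have := abs_add_le (y s - y 0) (y 0)
    rw [sub_add_cancel] at this
    nlinarith [hs.2]
  rw [firstDrift, firstDrift, ← mul_sub, abs_mul, abs_of_pos (by positivity : 0 < 2 * κ)]
  have h := abs_bias_sub_le hp (2 * κ * s * y s) (2 * κ * t * y t)
  have h4 : |2 * κ * s * y s - 2 * κ * t * y t| ≤ 2 * κ * (|y 0| + 2 * κ) * |s - t| := by
    calc _ = |2 * κ * ((s - t) * y s + t * (y s - y t))| := by ring_nf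
      _ = 2 * κ * |(s - t) * y s + t * (y s - y t)| := by
        rw [abs_mul, abs_of_pos (by positivity : 0 < 2 * κ)]
      _ ≤ 2 * κ * (|s - t| * |y s| + t * |y s - y t|) := by
        gcongr
        refine (abs_add_le _ _).trans ?_
        rw [abs_mul, abs_mul, abs_of_nonneg ht.1]
      _ ≤ 2 * κ * (|s - t| * (|y 0| + κ) + 1 / 2 * (2 * κ * |s - t|)) := by
        have := ht.1
        have := ht.2
        gcongr
      _ = _ := by ring
  calc _ ≤ 2 * κ * (2 * κ * (|y 0| + 2 * κ) * |s - t|) := by gcongr; exact h.trans h4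
    _ = _ := by ring

/-- The distribution function of the mixture transported by the first phase. -/
def mixtureCDF (p κ t x : ℝ) : ℝ :=
  p * cdf (gaussianReal 0 1) (x - 2 * κ * t) + (1 - p) * cdf (gaussianReal 0 1) (x + 2 * κ * t)

/-- The distribution function is conserved along the flow. -/
lemma mixtureCDF_solution (hp : p ∈ Set.Icc (0 : ℝ) 1) {y : ℝ → ℝ}
    (hy : ∀ t ∈ Set.Icc (0 : ℝ) (1 / 2),
      HasDerivWithinAt y (firstDrift p κ t (y t)) (Set.Icc 0 (1 / 2)) t) :
    mixtureCDF p κ (1 / 2) (y (1 / 2)) = cdf (gaussianReal 0 1) (y 0) := by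
  have hderiv : ∀ t ∈ Set.Icc (0 : ℝ) (1 / 2),
      HasDerivWithinAt (fun t => mixtureCDF p κ t (y t)) 0 (Set.Icc 0 (1 / 2)) t := by
    intro t ht
    have hlin : HasDerivWithinAt (fun t : ℝ => 2 * κ * t) (2 * κ) (Set.Icc 0 (1 / 2)) t := by
      simpa using (hasDerivWithinAt_id t (Set.Icc (0 : ℝ) (1 / 2))).const_mul (2 * κ)
    have h1 := (hasDerivAt_cdf_gaussianReal (y t - 2 * κ * t)).comp_hasDerivWithinAt t
      ((hy t ht).sub hlin)
    have h2 := (hasDerivAt_cdf_gaussianReal (y t + 2 * κ * t)).comp_hasDerivWithinAt t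
      ((hy t ht).add hlin)
    refine ((h1.const_mul p).add (h2.const_mul (1 - p))).congr_deriv ?_
    -- The two densities share a factor and differ by `exp (± u)`, `u = 2κty`. The derivative is
    -- thus proportional to `p e^u (y' - 2κ) + (1 - p) e^{-u} (y' + 2κ)`, which vanishes for `y' =
    -- 2κ bias p u`.
    have e1 : ∀ s : ℝ, s ^ 2 = 1 → gaussianPDFReal 0 1 (y t - s * (2 * κ * t))
        = (√(2 * Real.pi))⁻¹ * Real.exp (-(y t ^ 2 + (2 * κ * t) ^ 2) / 2)
          * Real.exp (s * (2 * κ * t * y t)) := by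
      intro s hs
      simp only [gaussianPDFReal, NNReal.coe_one, mul_one, sub_zero]
      rw [mul_assoc (√(2 * Real.pi))⁻¹, ← Real.exp_add]
      congr 2
      linear_combination (-(2 * κ * t) ^ 2 / 2) * hs
    have e2 := e1 1 (by norm_num)
    have e3 := e1 (-1) (by norm_num)
    rw [one_mul, one_mul] at e2
    rw [neg_one_mul, neg_one_mul, sub_neg_eq_add] at e3
    rw [e2, e3, firstDrift, bias]
    have := (bias_denom_pos hp (2 * κ * t * y t)).ne'
    generalize Real.exp (2 * κ * t * y t) = E₁ at *
    generalize Real.exp (-(2 * κ * t * y t)) = E₂ at *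
    field_simp
    ring
  have := (convex_Icc (0 : ℝ) (1 / 2)).norm_image_sub_le_of_norm_hasDerivWithin_le
    (C := 0) hderiv (by simp) (Set.left_mem_Icc.2 (by norm_num))
    (Set.right_mem_Icc.2 (by norm_num))
  rw [zero_mul, norm_le_zero_iff, sub_eq_zero] at this
  rw [this, mixtureCDF]
  simp only [mul_zero, sub_zero, add_zero]
  ring

/-- The mixture of the Gaussians `N(± κ, 1)` with weights `p` and `1 - p`. -/
def realMixture (p κ : ℝ) : Measure ℝ :=
  ENNReal.ofReal p • gaussianReal κ 1 + ENNReal.ofReal (1 - p) • gaussianReal (-κ) 1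

lemma isProbabilityMeasure_realMixture (hp : p ∈ Set.Icc (0 : ℝ) 1) :
    IsProbabilityMeasure (realMixture p κ) := by
  constructor
  simp [realMixture, ← ENNReal.ofReal_add hp.1 (sub_nonneg.2 hp.2)]

lemma realMixture_Iic (hp : p ∈ Set.Icc (0 : ℝ) 1) (c : ℝ) :
    realMixture p κ (Set.Iic c) = ENNReal.ofReal (mixtureCDF p κ (1 / 2) c) := by
  have hp1 : 0 ≤ 1 - p := sub_nonneg.2 hp.2
  rw [realMixture]
  simp only [Measure.add_apply, Measure.smul_apply, smul_eq_mul, gaussianReal_Iic]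
  rw [← ENNReal.ofReal_mul hp.1, ← ENNReal.ofReal_mul hp1, ← ENNReal.ofReal_add
    (mul_nonneg hp.1 (cdf_nonneg _ _)) (mul_nonneg hp1 (cdf_nonneg _ _)), mixtureCDF]
  congr 4 <;> ring

/-- The hypothesis says that `ψ` is the quantile transform between the two laws. The mixture's
distribution function at `c` lies between two values of the normal one, so it is itself such a
value, and `ψ` pulls half-lines back to half-lines. -/
lemma map_solution_eq_realMixture (hp : p ∈ Set.Icc (0 : ℝ) 1) (hκ : 0 < κ) {ψ : ℝ → ℝ}
    (hψ : Measurable ψ)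
    (h : ∀ x, mixtureCDF p κ (1 / 2) (ψ x) = cdf (gaussianReal 0 1) x) :
    (gaussianReal 0 1).map ψ = realMixture p κ := by
  have hp1 : 0 ≤ 1 - p := sub_nonneg.2 hp.2
  have hΦ := strictMono_cdf_gaussianReal
  have := isProbabilityMeasure_realMixture (κ := κ) hp
  have := Measure.isProbabilityMeasure_map (μ := gaussianReal 0 1) hψ.aemeasurable
  have hF : StrictMono (mixtureCDF p κ (1 / 2)) := by
    intro a b hab
    have h1 := hΦ (show a - 2 * κ * (1 / 2) < b - 2 * κ * (1 / 2) by linarith)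
    have h2 := hΦ (show a + 2 * κ * (1 / 2) < b + 2 * κ * (1 / 2) by linarith)
    unfold mixtureCDF
    rcases hp.1.eq_or_lt with rfl | hp0
    · linarith
    · nlinarith
  refine Measure.ext_of_Iic _ _ fun c => ?_
  obtain ⟨x, -, hx⟩ : mixtureCDF p κ (1 / 2) c ∈
      cdf (gaussianReal 0 1) '' Set.Icc (c - 2 * κ * (1 / 2)) (c + 2 * κ * (1 / 2)) := by
    refine intermediate_value_Icc (by linarith) continuous_cdf_gaussianReal.continuousOn ?_
    have := hΦ.monotone (show c - 2 * κ * (1 / 2) ≤ c + 2 * κ * (1 / 2) by linarith)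
    constructor <;> unfold mixtureCDF <;> nlinarith [hp.1]
  have hset : ψ ⁻¹' Set.Iic c = Set.Iic x := by
    ext u
    rw [Set.mem_preimage, Set.mem_Iic, ← hF.le_iff_le, h, ← hx, hΦ.le_iff_le, Set.mem_Iic]
  rw [Measure.map_apply hψ measurableSet_Iic, hset, gaussianReal_Iic, sub_zero, hx,
    realMixture_Iic hp]

lemma continuous_firstDrift (hp : p ∈ Set.Icc (0 : ℝ) 1) (κ t : ℝ) :
    Continuous (firstDrift p κ t) :=
  continuous_const.mul ((continuous_bias hp).comp (g := bias p) (f := fun x => 2 * κ * t * x)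
    (by fun_prop))

/-- The flow of the first phase, as the limit of its Euler schemes. -/
theorem exists_firstFlow (hp : p ∈ Set.Icc (0 : ℝ) 1) (hκ : 0 < κ) :
    ∃ μ : ℝ → ℝ → ℝ, (∀ t, Measurable (μ t)) ∧ (∀ x, μ 0 x = x) ∧
      (∀ x, ∀ t ∈ Set.Icc (0 : ℝ) (1 / 2), HasDerivWithinAt (fun u => μ u x)
        (firstDrift p κ t (μ t x)) (Set.Icc 0 (1 / 2)) t) ∧
      (∀ x, ∀ t ∈ Set.Icc (0 : ℝ) (1 / 2), Tendsto (fun N : ℕ =>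
        gridPath N (fun k => firstDrift p κ ((k : ℝ) / N)) t x) atTop (𝓝 (μ t x))) ∧
      (gaussianReal 0 1).map (μ (1 / 2)) = realMixture p κ := by
  choose y hy0 hy using exists_firstDrift_solution hp hκ
  have hlim : ∀ x, ∀ t ∈ Set.Icc (0 : ℝ) (1 / 2), Tendsto (fun N : ℕ =>
        gridPath N (fun k => firstDrift p κ ((k : ℝ) / N)) t x) atTop (𝓝 (y x t)) := by
    intro x t ht
    have := tendsto_gridPath_ode (by positivity) (by positivity) (hy x)
      (fun t ht => firstDrift_lipschitz hp hκ ht)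
      (fun s hs t ht => abs_firstDrift_solution_sub_le hp hκ (hy x) hs ht) ht
    rwa [hy0] at this
  have hmeas : ∀ t ∈ Set.Icc (0 : ℝ) (1 / 2), Measurable fun x => y x t := fun t ht =>
    measurable_of_tendsto_metrizable (fun N : ℕ =>
      (continuous_gridPath (fun k => continuous_firstDrift hp κ ((k : ℝ) / N)) t).measurable)
      (tendsto_pi_nhds.2 fun x => hlim x t ht)
  -- Clamping the time gives measurability at every real time; outside the interval the chosen
  -- solutions are uncontrolled.
  set P : ℝ → ℝ := fun t => max 0 (min t (1 / 2)) with hP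
  have hPm : ∀ t, P t ∈ Set.Icc (0 : ℝ) (1 / 2) := fun t =>
    ⟨le_max_left _ _, max_le (by norm_num) (min_le_right _ _)⟩
  have hPe : ∀ t ∈ Set.Icc (0 : ℝ) (1 / 2), P t = t := fun t ht => by
    rw [hP]; simp only; rw [min_eq_left ht.2, max_eq_right ht.1]
  refine ⟨fun t x => y x (P t), fun t => hmeas _ (hPm t), fun x => ?_, fun x t ht => ?_,
    fun x t ht => ?_, ?_⟩
  · simp only [hPe 0 (by norm_num), hy0]
  · simp only [hPe t ht]
    exact (hy x t ht).congr (fun u hu => by rw [hPe u hu]) (by rw [hPe t ht])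
  · simp only [hPe t ht]
    exact hlim x t ht
  · have h12 := hPe (1 / 2) (by norm_num)
    refine map_solution_eq_realMixture hp hκ (hmeas _ (hPm _)) fun x => ?_
    simp only [h12]
    rw [mixtureCDF_solution hp (hy x), hy0]

end FirstDrift

/-! ### High-dimensional limits of the coefficients -/

section DimensionLimits

lemma tendsto_sqrt_natCast : Tendsto (fun d : ℕ => √(d : ℝ)) atTop atTop :=
  Real.tendsto_sqrt_atTop.comp tendsto_natCast_atTop_atTop

lemma tendsto_div_sqrt_natCast (c : ℝ) : Tendsto (fun d : ℕ => c / √(d : ℝ)) atTop (𝓝 0) :=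
  tendsto_sqrt_natCast.const_div_atTop c

lemma eventually_sqrt_natCast_pos : ∀ᶠ d : ℕ in atTop, 0 < √(d : ℝ) :=
  tendsto_sqrt_natCast.eventually_gt_atTop 0

/-- The limiting dilation as the dimension grows. -/
def limitDilation (t : ℝ) : ℝ := max 0 (2 * t - 1)

lemma limitDilation_nonneg (t : ℝ) : 0 ≤ limitDilation t := le_max_left _ _

lemma limitDilation_le_one {t : ℝ} (ht : t ≤ 1) : limitDilation t ≤ 1 :=
  max_le zero_le_one (by linarith)

lemma limitDilation_of_le {t : ℝ} (ht : t ≤ 1 / 2) : limitDilation t = 0 :=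
  max_eq_left (by linarith)

lemma limitDilation_of_ge {t : ℝ} (ht : 1 / 2 ≤ t) : limitDilation t = 2 * t - 1 :=
  max_eq_right (by linarith)

lemma tendsto_dilation (κ t : ℝ) :
    Tendsto (fun d => dilation κ d t) atTop (𝓝 (limitDilation t)) := by
  rcases le_total t (1 / 2) with h | h
  · rw [limitDilation_of_le h]
    simp only [dilation, if_pos h]
    exact tendsto_div_sqrt_natCast _
  · rw [limitDilation_of_ge h]
    simp only [dilation_of_half_le κ _ h]
    have h0 := tendsto_div_sqrt_natCast κ
    simpa using h0.add ((h0.const_sub 1).mul_const (2 * t - 1))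

lemma tendsto_speed_of_lt (κ : ℝ) {t : ℝ} (ht : t < 1 / 2) :
    Tendsto (fun d => speed κ d t) atTop (𝓝 0) := by
  simp only [speed, if_pos ht]
  exact tendsto_div_sqrt_natCast _

lemma tendsto_speed_of_ge (κ : ℝ) {t : ℝ} (ht : 1 / 2 ≤ t) :
    Tendsto (fun d => speed κ d t) atTop (𝓝 2) := by
  simp only [speed, if_neg (not_lt.2 ht)]
  simpa using ((tendsto_div_sqrt_natCast κ).const_sub 1).const_mul 2

variable {σ : ℝ}

lemma noiseVar_limitDilation_pos (hσ : 0 < σ) {t : ℝ} (ht : t ≤ 1) :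
    0 < noiseVar σ (limitDilation t) :=
  noiseVar_pos hσ (limitDilation_nonneg t) (limitDilation_le_one ht)

lemma tendsto_noiseVar (σ κ t : ℝ) : Tendsto (fun d => noiseVar σ (dilation κ d t)) atTop
    (𝓝 (noiseVar σ (limitDilation t))) := by
  unfold noiseVar
  exact (((tendsto_dilation κ t).pow 2).const_mul (σ ^ 2 - 1)).const_add 1

/-- The limiting rate of the orthogonal component as a function of the limiting dilation. -/
def limitRate (σ θ : ℝ) : ℝ := 2 / noiseVar σ θ * ((σ ^ 2 - 1) * θ)

/-- Before `1/2` the speed tends to `0` instead of `2`, but there the limiting dilation vanishes, so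
one formula covers both phases. -/
lemma tendsto_orthRate (hσ : 0 < σ) (κ : ℝ) {t : ℝ} (ht : t ≤ 1) :
    Tendsto (fun d => orthRate σ κ d t) atTop (𝓝 (limitRate σ (limitDilation t))) := by
  have hV := (noiseVar_limitDilation_pos hσ ht).ne'
  rcases lt_or_ge t (1 / 2) with h | h
  · have := ((tendsto_speed_of_lt κ h).div (tendsto_noiseVar σ κ t) hV).mul
      ((tendsto_dilation κ t).const_mul (σ ^ 2 - 1))
    rw [zero_div, zero_mul] at this
    rw [limitRate, limitDilation_of_le h.le, mul_zero, mul_zero]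
    exact this
  · exact ((tendsto_speed_of_ge κ h).div (tendsto_noiseVar σ κ t) hV).mul
      ((tendsto_dilation κ t).const_mul (σ ^ 2 - 1))

/-- Speed and dilation are both of order `1/√d`: their product kills the linear term, while the
factors `√d` outside and inside `bias` compensate them exactly. -/
lemma tendsto_overlapDrift_of_lt {p : ℝ} (hp : p ∈ Set.Icc (0 : ℝ) 1) (hσ : 0 < σ) (κ : ℝ) {t : ℝ}
    (ht : t < 1 / 2) {x : ℕ → ℝ} {y : ℝ} (hx : Tendsto x atTop (𝓝 y)) :
    Tendsto (fun d => overlapDrift p σ κ d t (x d)) atTop (𝓝 (firstDrift p κ t y)) := by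
  have hV := (noiseVar_limitDilation_pos hσ (by linarith : t ≤ 1)).ne'
  have hV1 : noiseVar σ (limitDilation t) = 1 := by
    rw [limitDilation_of_le ht.le, noiseVar]; ring
  have h1 := (((tendsto_speed_of_lt κ ht).div (tendsto_noiseVar σ κ t) hV).mul
      (((tendsto_dilation κ t).const_mul (σ ^ 2 - 1)).mul hx))
  have h2 : Tendsto (fun d => 2 * κ / noiseVar σ (dilation κ d t)
      * bias p (2 * κ * t * x d / noiseVar σ (dilation κ d t))) atTop
      (𝓝 (2 * κ / noiseVar σ (limitDilation t)
        * bias p (2 * κ * t * y / noiseVar σ (limitDilation t)))) :=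
    ((tendsto_const_nhds (x := 2 * κ)).div (tendsto_noiseVar σ κ t) hV).mul
      (((continuous_bias hp).tendsto _).comp
        ((hx.const_mul (2 * κ * t)).div (tendsto_noiseVar σ κ t) hV))
  have h3 := h1.add h2
  rw [hV1, div_one, div_one, div_one, zero_mul, zero_add] at h3
  refine h3.congr' ?_
  filter_upwards [eventually_sqrt_natCast_pos] with d hd
  have e1 : dilation κ d t * √(d : ℝ) = 2 * κ * t := by
    rw [dilation, if_pos ht.le]; field_simp
  have e2 : speed κ d t * √(d : ℝ) = 2 * κ := by
    rw [speed, if_pos ht]; field_simp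
  rw [overlapDrift, e1, ← e2]
  simp only [Pi.div_apply]
  ring

/-- The first grid index at or after time `1 / 2`. -/
def halfIndex (N : ℕ) : ℕ := (N + 1) / 2

lemma lt_half_of_lt_halfIndex {N k : ℕ} (hk : k < halfIndex N) : (k : ℝ) / N < 1 / 2 := by
  have h : 2 * k < N := by unfold halfIndex at hk; omega
  have hN : (0 : ℝ) < N := by exact_mod_cast (by omega : 0 < N)
  rw [div_lt_iff₀ hN]
  have : (2 * k : ℝ) < N := by exact_mod_cast h
  linarith

lemma half_le_of_halfIndex_le {N k : ℕ} (hN : 0 < N) (hk : halfIndex N ≤ k) :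
    1 / 2 ≤ (k : ℝ) / N := by
  have h : N ≤ 2 * k := by unfold halfIndex at hk; omega
  have hN : (0 : ℝ) < N := by exact_mod_cast hN
  rw [le_div_iff₀ hN]
  have : (N : ℝ) ≤ 2 * k := by exact_mod_cast h
  linarith

/-- The limiting scheme of the overlap in the first phase. -/
def firstEuler (p κ : ℝ) (N : ℕ) : ℕ → ℝ → ℝ :=
  gridEuler N fun k => firstDrift p κ ((k : ℝ) / N)

lemma tendsto_overlapEuler {p : ℝ} (hp : p ∈ Set.Icc (0 : ℝ) 1) (hσ : 0 < σ) (κ : ℝ) (N : ℕ)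
    (x : ℝ) {k : ℕ} (hk : k ≤ halfIndex N) :
    Tendsto (fun d => overlapEuler p σ κ d N k x) atTop (𝓝 (firstEuler p κ N k x)) :=
  tendsto_gridEuler (f := fun d k => overlapDrift p σ κ d ((k : ℝ) / N)) tendsto_const_nhds
    (fun _ hk h => tendsto_overlapDrift_of_lt hp hσ κ (lt_half_of_lt_halfIndex hk) h) hk

lemma tendsto_overlapPath {p : ℝ} (hp : p ∈ Set.Icc (0 : ℝ) 1) (hσ : 0 < σ) (κ : ℝ) {N : ℕ}
    (hN : 0 < N) (x : ℝ) {t : ℝ} (ht : t ∈ Set.Icc (0 : ℝ) (1 / 2)) :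
    Tendsto (fun d => overlapPath p σ κ d N t x) atTop
      (𝓝 (gridPath N (fun k => firstDrift p κ ((k : ℝ) / N)) t x)) :=
  tendsto_gridPath (f := fun d k => overlapDrift p σ κ d ((k : ℝ) / N)) hN tendsto_const_nhds
    (fun _ hk h => tendsto_overlapDrift_of_lt hp hσ κ (lt_half_of_lt_halfIndex hk) h) ht.1
    (ht.2.trans (half_le_of_halfIndex_le hN le_rfl))

end DimensionLimits

/-! ### The orthogonal component -/

section Orthogonal

variable {σ : ℝ}

lemma abs_limitDilation_sub_le (s t : ℝ) :
    |limitDilation s - limitDilation t| ≤ 2 * |s - t| := by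
  have := abs_max_sub_max_le_abs (2 * s - 1) (2 * t - 1) 0
  rw [max_comm, max_comm _ (0 : ℝ)] at this
  calc _ ≤ _ := this
    _ = |2 * (s - t)| := by ring_nf
    _ = _ := by rw [abs_mul, abs_two]

/-- The kink at `1/2` sits at a zero and disappears on squaring. Hence `√V` is a classical solution
on all of `[0, 1]` and both phases are handled by a single equation. -/
lemma hasDerivAt_limitDilation_sq (t : ℝ) :
    HasDerivAt (fun t => limitDilation t ^ 2) (4 * limitDilation t) t := by
  rw [hasDerivAt_iff_isLittleO]
  have h : (fun s => limitDilation s ^ 2 - limitDilation t ^ 2 - (s - t) • (4 * limitDilation t))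
      =O[𝓝 t] fun s => ‖s - t‖ ^ 2 := by
    refine Asymptotics.IsBigO.of_bound 4 (Eventually.of_forall fun s => ?_)
    rw [norm_pow, norm_norm, Real.norm_eq_abs, Real.norm_eq_abs, sq_abs, smul_eq_mul]
    unfold limitDilation
    rw [abs_le]
    rcases max_cases (0 : ℝ) (2 * s - 1) with ⟨e, h⟩ | ⟨e, h⟩ <;>
      rcases max_cases (0 : ℝ) (2 * t - 1) with ⟨e', h'⟩ | ⟨e', h'⟩ <;> rw [e, e'] <;>
      constructor <;> nlinarith
  exact h.trans_isLittleO (Asymptotics.isLittleO_pow_sub_sub t one_lt_two)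

lemma contDiffOn_noiseVar (σ : ℝ) : ContDiffOn ℝ 1 (noiseVar σ) (Set.Icc 0 1) := by
  unfold noiseVar; fun_prop

lemma contDiffOn_limitRate (hσ : 0 < σ) : ContDiffOn ℝ 1 (limitRate σ) (Set.Icc 0 1) := by
  unfold limitRate
  refine (contDiffOn_const.div (contDiffOn_noiseVar σ) fun θ hθ => ?_).mul (by fun_prop)
  exact (noiseVar_pos hσ hθ.1 hθ.2).ne'

lemma exists_bound_limitRate (hσ : 0 < σ) :
    ∃ C, 0 ≤ C ∧ ∀ θ ∈ Set.Icc (0 : ℝ) 1, |limitRate σ θ| ≤ C := by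
  obtain ⟨C, hC⟩ := isCompact_Icc.exists_bound_of_continuousOn (contDiffOn_limitRate hσ).continuousOn
  exact ⟨C, (norm_nonneg _).trans (hC 0 (by norm_num)), hC⟩

lemma tendsto_gridPath_orth (hσ : 0 < σ) {t : ℝ} (ht : t ∈ Set.Icc (0 : ℝ) 1) :
    Tendsto (fun N : ℕ => gridPath N
      (fun k y => limitRate σ (limitDilation ((k : ℝ) / N)) * y) t 1) atTop
      (𝓝 (√(noiseVar σ (limitDilation t)))) := by
  have hmem : ∀ t ∈ Set.Icc (0 : ℝ) 1, limitDilation t ∈ Set.Icc (0 : ℝ) 1 := fun t ht =>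
    ⟨limitDilation_nonneg t, limitDilation_le_one ht.2⟩
  obtain ⟨K, hK0, hK⟩ := exists_bound_limitRate hσ
  have hcd : ContDiffOn ℝ 1 (fun θ => limitRate σ θ * √(noiseVar σ θ)) (Set.Icc 0 1) :=
    (contDiffOn_limitRate hσ).mul ((contDiffOn_noiseVar σ).sqrt
      fun θ hθ => (noiseVar_pos hσ hθ.1 hθ.2).ne')
  obtain ⟨L, hL⟩ := hcd.exists_lipschitzOnWith one_ne_zero (convex_Icc _ _) isCompact_Icc
  have := tendsto_gridPath_ode (f := fun t x => limitRate σ (limitDilation t) * x)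
    (y := fun t => √(noiseVar σ (limitDilation t))) (b := 1) (K := K) (L := L * 2)
    hK0 (by positivity) (fun t ht => ?_) (fun t ht u v => ?_) (fun s hs t ht => ?_) ht
  · have h0 : √(noiseVar σ (limitDilation 0)) = 1 := by
      rw [limitDilation_of_le (by norm_num), noiseVar]; simp
    rwa [h0] at this
  · have hV := noiseVar_limitDilation_pos hσ ht.2
    have h1 := (((hasDerivAt_limitDilation_sq t).const_mul (σ ^ 2 - 1)).const_add 1).sqrt hV.ne'
    refine h1.hasDerivWithinAt.congr_deriv ?_
    have hs : 0 < √(noiseVar σ (limitDilation t)) := Real.sqrt_pos.2 hV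
    change _ / (2 * √(noiseVar σ (limitDilation t))) = _
    rw [limitRate]
    field_simp
    rw [Real.sq_sqrt hV.le]
    ring
  · rw [← mul_sub, abs_mul]
    gcongr
    exact hK _ (hmem t ht)
  · have h1 := hL.dist_le_mul _ (hmem s hs) _ (hmem t ht)
    rw [Real.dist_eq, Real.dist_eq] at h1
    refine h1.trans ?_
    rw [mul_assoc]
    gcongr
    exact abs_limitDilation_sub_le s t

theorem iteratedLimit_orthPath (hσ : 0 < σ) (κ : ℝ) {t : ℝ} (ht : t ∈ Set.Icc (0 : ℝ) 1) :
    IteratedLimit (fun N d => |orthPath σ κ d N t|) (√(noiseVar σ (limitDilation t))) := by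
  refine ⟨fun N => |gridPath N
    (fun k y => limitRate σ (limitDilation ((k : ℝ) / N)) * y) t 1|, ?_, ?_⟩
  · filter_upwards [eventually_gt_atTop 0] with N hN
    have hN' : (0 : ℝ) < N := by exact_mod_cast hN
    refine (tendsto_gridPath (K := N) (f := fun d k y => orthRate σ κ d ((k : ℝ) / N) * y) hN
      tendsto_const_nhds (fun k hk h => ?_) ht.1 (by rw [div_self hN'.ne']; exact ht.2)).abs
    refine (tendsto_orthRate hσ κ ?_).mul h
    rw [div_le_one hN']
    exact_mod_cast hk.le
  · have := (tendsto_gridPath_orth hσ ht).abs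
    rwa [abs_of_nonneg (Real.sqrt_nonneg _)] at this

end Orthogonal

/-! ### Saturation of the posterior mean -/

section BiasLimits

lemma bias_neg (p u : ℝ) : bias p (-u) = -bias (1 - p) u := by
  unfold bias
  rw [← neg_div, neg_neg]
  congr 1 <;> ring

lemma tendsto_bias_atTop {p : ℝ} (hp : p ∈ Set.Icc (0 : ℝ) 1) (hp0 : 0 < p) :
    Tendsto (bias p) atTop (𝓝 1) := by
  have hE : Tendsto (fun u : ℝ => Real.exp (-u) / Real.exp u) atTop (𝓝 0) := by
    have : (fun u : ℝ => Real.exp (-u) / Real.exp u) = fun u => Real.exp (-(2 * u)) := by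
      ext u; rw [← Real.exp_sub]; ring_nf
    rw [this]
    exact Real.tendsto_exp_neg_atTop_nhds_zero.comp (tendsto_id.const_mul_atTop two_pos)
  have h := ((hE.const_mul (1 - p)).const_sub p).div ((hE.const_mul (1 - p)).const_add p)
    (by simpa using hp0.ne')
  rw [mul_zero, sub_zero, add_zero, div_self hp0.ne'] at h
  refine h.congr fun u => ?_
  have h0 := (bias_denom_pos hp u).ne'
  have h1 : p + (1 - p) * (Real.exp (-u) / Real.exp u) ≠ 0 := by
    have : p + (1 - p) * (Real.exp (-u) / Real.exp u)
        = (p * Real.exp u + (1 - p) * Real.exp (-u)) / Real.exp u := by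
      field_simp
    rw [this]
    exact div_ne_zero h0 (Real.exp_ne_zero u)
  simp only [Pi.div_apply]
  rw [bias, div_eq_div_iff h1 h0]
  field_simp

/-- The prior has to charge the mode `s`. The case `s = -1` follows from the symmetry exchanging `p`
and `1 - p`. -/
lemma tendsto_bias_of_sign {p s : ℝ} (hp : p ∈ Set.Icc (0 : ℝ) 1)
    (hs : (s = 1 ∧ 0 < p) ∨ (s = -1 ∧ p < 1)) {ι : Type*} {l : Filter ι} {a : ι → ℝ}
    (ha : Tendsto (fun i => s * a i) l atTop) : Tendsto (fun i => bias p (a i)) l (𝓝 s) := by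
  rcases hs with ⟨rfl, h⟩ | ⟨rfl, h⟩
  · simp only [one_mul] at ha
    exact (tendsto_bias_atTop hp h).comp ha
  · have hp' : 1 - p ∈ Set.Icc (0 : ℝ) 1 := ⟨by linarith [hp.2], by linarith [hp.1]⟩
    have := ((tendsto_bias_atTop hp' (by linarith)).comp ha).neg
    refine this.congr fun i => ?_
    simp only [Function.comp_apply]
    rw [← bias_neg]
    ring_nf

end BiasLimits

/-! ### The limiting scheme of the second phase -/

section SecondScheme

/-- The vector field of the limiting scheme in the second phase, when the posterior mean of the
sign is `B` at the first step after time `1 / 2` and `S` afterwards. -/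
def secondField (σ : ℝ) (N : ℕ) (B S : ℝ) (k : ℕ) (M : ℝ) : ℝ :=
  if k < halfIndex N then 0 else
    2 / noiseVar σ (limitDilation ((k : ℝ) / N)) *
      ((σ ^ 2 - 1) * limitDilation ((k : ℝ) / N) * M + if k = halfIndex N then B else S)

variable {σ p κ : ℝ} {N : ℕ} {B S : ℝ}

lemma secondField_of_lt {k : ℕ} (hk : k < halfIndex N) (M : ℝ) : secondField σ N B S k M = 0 :=
  if_pos hk

lemma secondField_halfIndex (M : ℝ) : secondField σ N B S (halfIndex N) M =
    2 / noiseVar σ (limitDilation ((halfIndex N : ℝ) / N)) *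
      ((σ ^ 2 - 1) * limitDilation ((halfIndex N : ℝ) / N) * M + B) := by
  simp [secondField]

lemma secondField_of_gt {k : ℕ} (hk : halfIndex N < k) (M : ℝ) : secondField σ N B S k M =
    limitRate σ (limitDilation ((k : ℝ) / N)) * M
      + 2 / noiseVar σ (limitDilation ((k : ℝ) / N)) * S := by
  rw [secondField, if_neg (by omega), if_neg (by omega), limitRate]
  ring

lemma gridEuler_secondField_of_le {k : ℕ} (hk : k ≤ halfIndex N) :
    gridEuler N (secondField σ N B S) k 0 = 0 := by
  induction k with
  | zero => rfl
  | succ k ih => rw [gridEuler, ih (by omega), secondField_of_lt (by omega)]; simp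

lemma gridEuler_secondField_succ_halfIndex :
    gridEuler N (secondField σ N B S) (halfIndex N + 1) 0
      = 1 / (N : ℝ) * (2 / noiseVar σ (limitDilation ((halfIndex N : ℝ) / N)) * B) := by
  rw [gridEuler, gridEuler_secondField_of_le le_rfl, secondField_halfIndex]
  simp

/-- A step multiplies `S M` by `1 + rate/N`, which is nonnegative for such `N`, and adds a positive
amount. The sign chosen at the first step is therefore never lost, which keeps the posterior mean
saturated. -/
lemma mul_gridEuler_secondField_pos (hσ : 0 < σ) (hN : 0 < N)
    (hrate : ∀ θ ∈ Set.Icc (0 : ℝ) 1, |limitRate σ θ| ≤ N) (hBS : 0 < S * B) (hS : S ^ 2 = 1)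
    {k : ℕ} (hk : halfIndex N < k) (hkN : k ≤ N) :
    0 < S * gridEuler N (secondField σ N B S) k 0 := by
  have hN' : (0 : ℝ) < N := by exact_mod_cast hN
  have hle : ∀ k : ℕ, k ≤ N → (k : ℝ) / N ≤ 1 := fun k hk => by
    rw [div_le_one hN']; exact_mod_cast hk
  induction k, hk using Nat.le_induction with
  | base =>
    rw [gridEuler_secondField_succ_halfIndex]
    have := noiseVar_limitDilation_pos hσ (hle (halfIndex N) (by omega))
    calc 0 < 1 / (N : ℝ) * (2 / noiseVar σ (limitDilation ((halfIndex N : ℝ) / N))) * (S * B) := by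
          positivity
      _ = _ := by ring
  | succ k hk ih =>
    have h := ih (by omega)
    rw [gridEuler, secondField_of_gt hk]
    set m := gridEuler N (secondField σ N B S) k 0
    have hV := noiseVar_limitDilation_pos hσ (hle k (by omega))
    have hr := hrate _ ⟨limitDilation_nonneg _, limitDilation_le_one (hle k (by omega))⟩
    set c := limitRate σ (limitDilation ((k : ℝ) / N))
    have hc : 0 ≤ 1 + 1 / (N : ℝ) * c := by
      have h1 := (abs_le.1 hr).1
      have : 1 / (N : ℝ) * (-N) ≤ 1 / (N : ℝ) * c := by gcongr
      have h2 : 1 / (N : ℝ) * (-N) = -1 := by field_simp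
      linarith
    have h3 : 0 < 1 / (N : ℝ) * (2 / noiseVar σ (limitDilation ((k : ℝ) / N))) := by positivity
    calc 0 < (1 + 1 / (N : ℝ) * c) * (S * m)
          + 1 / (N : ℝ) * (2 / noiseVar σ (limitDilation ((k : ℝ) / N))) * S ^ 2 := by
          rw [hS, mul_one]; have := mul_nonneg hc h.le; linarith
      _ = _ := by simp only [smul_eq_mul]; ring

/-- One step of the second phase multiplies the distance to the exact solution. -/
lemma secondField_step (θ h M : ℝ) (hθ : noiseVar σ θ ≠ 0) :
    M + h * (limitRate σ θ * M + 2 / noiseVar σ θ * S) - S * (θ + 2 * h)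
      = (1 + h * limitRate σ θ) * (M - S * θ) := by
  have e : noiseVar σ θ = 1 + (σ ^ 2 - 1) * θ ^ 2 := rfl
  rw [limitRate]
  field_simp
  rw [e]
  ring

/-- After the first step `M` is at most `2/(vN)`, and `θ` at most `3/N` as `2 (halfIndex N + 1) ≤ N
+ 3`. Each later step multiplies the deviation by at most `exp (C/N)`. -/
lemma abs_gridEuler_secondField_sub_le (hN : 0 < N) {C v : ℝ} (hC : 0 ≤ C)
    (hrate : ∀ θ ∈ Set.Icc (0 : ℝ) 1, |limitRate σ θ| ≤ C) (hv : 0 < v)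
    (hv' : ∀ θ ∈ Set.Icc (0 : ℝ) 1, v ≤ noiseVar σ θ) (hB : |B| ≤ 1) (hS : |S| ≤ 1) {k : ℕ}
    (hk : halfIndex N < k) (hkN : k ≤ N) :
    |gridEuler N (secondField σ N B S) k 0 - S * limitDilation ((k : ℝ) / N)|
      ≤ (2 / v + 3) / N * Real.exp (C * ((k : ℝ) / N)) := by
  have hN' : (0 : ℝ) < N := by exact_mod_cast hN
  have hle : ∀ k : ℕ, k ≤ N → (k : ℝ) / N ≤ 1 := fun k hk => by
    rw [div_le_one hN']; exact_mod_cast hk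
  have hmem : ∀ k : ℕ, k ≤ N → limitDilation ((k : ℝ) / N) ∈ Set.Icc (0 : ℝ) 1 := fun k hk =>
    ⟨limitDilation_nonneg _, limitDilation_le_one (hle k hk)⟩
  induction k, hk using Nat.le_induction with
  | base =>
    rw [Nat.succ_eq_add_one, gridEuler_secondField_succ_halfIndex]
    have h1 := hv' _ (hmem (halfIndex N) (by omega))
    have h2 : limitDilation (((halfIndex N + 1 : ℕ) : ℝ) / N) ≤ 3 / N := by
      rw [limitDilation_of_ge (half_le_of_halfIndex_le hN (by omega))]
      have : 2 * (halfIndex N + 1) ≤ N + 3 := by unfold halfIndex; omega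
      have : 2 * ((halfIndex N + 1 : ℕ) : ℝ) ≤ N + 3 := by exact_mod_cast this
      rw [show 2 * (((halfIndex N + 1 : ℕ) : ℝ) / N) - 1
        = (2 * ((halfIndex N + 1 : ℕ) : ℝ) - N) / N by field_simp]
      gcongr
      linarith
    have h3 := limitDilation_nonneg (((halfIndex N + 1 : ℕ) : ℝ) / N)
    have hE : 1 ≤ Real.exp (C * (((halfIndex N + 1 : ℕ) : ℝ) / N)) :=
      Real.one_le_exp (by positivity)
    set V := noiseVar σ (limitDilation ((halfIndex N : ℝ) / N))
    have hV : 0 < V := hv.trans_le h1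
    calc _ ≤ |1 / (N : ℝ) * (2 / V * B)| + |S * limitDilation (((halfIndex N + 1 : ℕ) : ℝ) / N)| :=
          abs_sub _ _
      _ = 1 / (N : ℝ) * (2 / V * |B|) + |S| * limitDilation (((halfIndex N + 1 : ℕ) : ℝ) / N) := by
          rw [abs_mul, abs_mul, abs_mul, abs_of_pos (by positivity : 0 < 1 / (N : ℝ)),
            abs_of_pos (by positivity : 0 < 2 / V), abs_of_nonneg h3]
      _ ≤ 1 / (N : ℝ) * (2 / v * 1) + 1 * (3 / N) := by gcongr
      _ = (2 / v + 3) / N * 1 := by ring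
      _ ≤ _ := by gcongr
  | succ k hk ih =>
    have h := ih (by omega)
    have hkN' : k ≤ N := by omega
    have hV : noiseVar σ (limitDilation ((k : ℝ) / N)) ≠ 0 := (hv.trans_le (hv' _ (hmem k hkN'))).ne'
    have hθ : limitDilation (((k + 1 : ℕ) : ℝ) / N) = limitDilation ((k : ℝ) / N) + 2 * (1 / N) := by
      rw [limitDilation_of_ge (half_le_of_halfIndex_le hN (by omega)),
        limitDilation_of_ge (half_le_of_halfIndex_le hN (by omega))]
      push_cast
      ring
    rw [gridEuler, secondField_of_gt hk, hθ, smul_eq_mul, secondField_step _ _ _ hV,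
      abs_mul]
    have hr := hrate _ (hmem k hkN')
    have h1 : |1 + 1 / (N : ℝ) * limitRate σ (limitDilation ((k : ℝ) / N))|
        ≤ Real.exp (C * (1 / N)) := by
      calc _ ≤ |(1 : ℝ)| + |1 / (N : ℝ) * limitRate σ (limitDilation ((k : ℝ) / N))| := abs_add_le _ _
        _ ≤ 1 + 1 / (N : ℝ) * C := by
          rw [abs_one, abs_mul, abs_of_pos (by positivity : 0 < 1 / (N : ℝ))]
          gcongr
        _ ≤ _ := by linarith [Real.add_one_le_exp (C * (1 / N))]
    calc _ ≤ Real.exp (C * (1 / N)) * ((2 / v + 3) / N * Real.exp (C * ((k : ℝ) / N))) := by gcongr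
      _ = (2 / v + 3) / N * (Real.exp (C * ((k : ℝ) / N)) * Real.exp (C * (1 / N))) := by ring
      _ = _ := by
        rw [← Real.exp_add]
        congr 2
        push_cast
        ring

lemma exists_noiseVar_lower (hσ : 0 < σ) :
    ∃ v, 0 < v ∧ ∀ θ ∈ Set.Icc (0 : ℝ) 1, v ≤ noiseVar σ θ := by
  obtain ⟨θ₀, h0, hmin⟩ := isCompact_Icc.exists_isMinOn (Set.nonempty_Icc.2 zero_le_one)
    (contDiffOn_noiseVar σ).continuousOn
  exact ⟨_, noiseVar_pos hσ h0.1 h0.2, fun θ hθ => hmin hθ⟩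

/-- The limiting schemes of the second phase converge to `S (2 t - 1)`. -/
theorem tendsto_gridPath_secondField (hσ : 0 < σ) {t : ℝ} (ht : t ∈ Set.Icc (1 / 2 : ℝ) 1)
    {n : ℕ → ℕ} (hn : Tendsto n atTop atTop) {B : ℕ → ℝ} (hB : ∀ i, |B i| ≤ 1) (hS : |S| ≤ 1) :
    Tendsto (fun i => gridPath (n i) (secondField σ (n i) (B i) S) t 0) atTop
      (𝓝 (S * (2 * t - 1))) := by
  -- Time `1/2` lies in the cell that ends at `halfIndex`, where the scheme still vanishes; for `t >
  -- 1/2` the cell of `t` is eventually beyond the first step.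
  rcases ht.1.eq_or_lt with rfl | ht1
  · refine tendsto_const_nhds.congr' ?_
    filter_upwards [hn.eventually_gt_atTop 0] with i hi
    have hhalf : 0 < halfIndex (n i) := by unfold halfIndex; omega
    obtain ⟨k, hk⟩ : ∃ k, halfIndex (n i) = k + 1 := ⟨_, (Nat.succ_pred_eq_of_pos hhalf).symm⟩
    rw [gridPath_of_mem hi _ _ (lt_half_of_lt_halfIndex (k := k) (by omega)).le
      (half_le_of_halfIndex_le hi (by omega)), gridEuler_secondField_of_le (by omega),
      secondField_of_lt (by omega)]
    simp
  obtain ⟨C, hC, hrate⟩ := exists_bound_limitRate hσ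
  obtain ⟨v, hv, hv'⟩ := exists_noiseVar_lower hσ
  rw [tendsto_iff_norm_sub_tendsto_zero]
  have hlim : Tendsto (fun i => (1 + C) * ((2 / v + 3) / (n i : ℝ) * Real.exp C)) atTop (𝓝 0) := by
    have := ((tendsto_natCast_atTop_atTop (R := ℝ)).comp hn).const_div_atTop (2 / v + 3)
    simpa using (this.mul_const (Real.exp C)).const_mul (1 + C)
  refine squeeze_zero' (Eventually.of_forall fun _ => norm_nonneg _) ?_ hlim
  filter_upwards [hn.eventually_gt_atTop 0,
    ((tendsto_natCast_atTop_atTop (R := ℝ)).comp hn).eventually_ge_atTop (2 / (t - 1 / 2))]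
    with i hi hi2
  set N := n i
  have hN' : (0 : ℝ) < N := by exact_mod_cast hi
  have hlarge : 2 ≤ (N : ℝ) * (t - 1 / 2) := by
    rwa [Function.comp_apply, div_le_iff₀ (by linarith)] at hi2
  have ht0 : 0 ≤ t := by linarith
  have hfl : (⌊t * N⌋₊ : ℝ) ≤ t * N := Nat.floor_le (mul_nonneg ht0 hN'.le)
  have hfl' := Nat.lt_floor_add_one (t * N)
  have hkN : ⌊t * N⌋₊ ≤ N := Nat.floor_le_of_le (by nlinarith [ht.2])
  have hk : halfIndex N < ⌊t * N⌋₊ := by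
    have h1 : 2 * halfIndex N ≤ N + 1 := by unfold halfIndex; omega
    have h2 : 2 * (halfIndex N : ℝ) ≤ N + 1 := by exact_mod_cast h1
    have : (halfIndex N : ℝ) < ⌊t * N⌋₊ := by linarith
    exact_mod_cast this
  have hle1 : (⌊t * N⌋₊ : ℝ) / N ≤ 1 := by rw [div_le_one hN']; exact_mod_cast hkN
  have hle : (⌊t * N⌋₊ : ℝ) / N ≤ t := by rwa [div_le_iff₀ hN']
  have hmem : limitDilation ((⌊t * N⌋₊ : ℝ) / N) ∈ Set.Icc (0 : ℝ) 1 :=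
    ⟨limitDilation_nonneg _, limitDilation_le_one hle1⟩
  have herr := abs_gridEuler_secondField_sub_le hi hC hrate hv hv' (hB i) hS hk hkN
  have hθ : 2 * t - 1 = limitDilation ((⌊t * N⌋₊ : ℝ) / N) + 2 * (t - (⌊t * N⌋₊ : ℝ) / N) := by
    rw [limitDilation_of_ge (half_le_of_halfIndex_le hi hk.le)]
    ring
  rw [gridPath, secondField_of_gt hk, smul_eq_mul, hθ, secondField_step _ _ _
    (hv.trans_le (hv' _ hmem)).ne', norm_mul, Real.norm_eq_abs, Real.norm_eq_abs]
  have hr := hrate _ hmem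
  have h1 : |1 + (t - (⌊t * N⌋₊ : ℝ) / N) * limitRate σ (limitDilation ((⌊t * N⌋₊ : ℝ) / N))|
      ≤ 1 + C := by
    refine (abs_add_le _ _).trans ?_
    rw [abs_one, abs_mul, abs_of_nonneg (by linarith)]
    have h2 : t - (⌊t * N⌋₊ : ℝ) / N ≤ 1 := by
      have : (0 : ℝ) ≤ (⌊t * N⌋₊ : ℝ) / N := by positivity
      linarith [ht.2]
    have := mul_le_mul h2 hr (abs_nonneg _) zero_le_one
    linarith
  gcongr
  refine herr.trans ?_
  gcongr
  calc C * ((⌊t * N⌋₊ : ℝ) / N) ≤ C * 1 := by gcongr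
    _ = C := mul_one C

/-- In the second phase, the overlap on the scale of the dimension follows the limiting scheme. -/
theorem tendsto_overlapPath_div (hp : p ∈ Set.Icc (0 : ℝ) 1) (hσ : 0 < σ) (hN : 0 < N)
    (hrate : ∀ θ ∈ Set.Icc (0 : ℝ) 1, |limitRate σ θ| ≤ N) {x : ℝ}
    (hS : (S = 1 ∧ 0 < p) ∨ (S = -1 ∧ p < 1)) (hBS : 0 < S * B)
    (hB : Tendsto (fun d : ℕ => bias p (dilation κ d ((halfIndex N : ℝ) / N) * √(d : ℝ)
      * overlapEuler p σ κ d N (halfIndex N) x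
        / noiseVar σ (dilation κ d ((halfIndex N : ℝ) / N)))) atTop (𝓝 B))
    {t : ℝ} (ht : t ∈ Set.Icc (0 : ℝ) 1) :
    Tendsto (fun d : ℕ => overlapPath p σ κ d N t x / √(d : ℝ)) atTop
      (𝓝 (gridPath N (secondField σ N B S) t 0)) := by
  have hN' : (0 : ℝ) < N := by exact_mod_cast hN
  have hS2 : S ^ 2 = 1 := by rcases hS with ⟨rfl, -⟩ | ⟨rfl, -⟩ <;> norm_num
  have hle : ∀ k : ℕ, k < N → (k : ℝ) / N ≤ 1 := fun k hk => by
    rw [div_le_one hN']; exact_mod_cast hk.le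
  set f : ℕ → ℕ → ℝ → ℝ := fun d k y =>
    overlapDrift p σ κ d ((k : ℝ) / N) (√(d : ℝ) * y) / √(d : ℝ) with hf
  have hpath : ∀ᶠ d : ℕ in atTop, gridPath N (f d) t (x / √(d : ℝ))
      = overlapPath p σ κ d N t x / √(d : ℝ) := by
    filter_upwards [eventually_sqrt_natCast_pos] with d hd
    exact (gridPath_div _ hd.ne' x t).symm
  have heul : ∀ k, ∀ᶠ d : ℕ in atTop, √(d : ℝ) * gridEuler N (f d) k (x / √(d : ℝ))
      = overlapEuler p σ κ d N k x := by
    intro k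
    filter_upwards [eventually_sqrt_natCast_pos] with d hd
    rw [hf, ← gridEuler_div (fun k => overlapDrift p σ κ d ((k : ℝ) / N)) hd.ne',
      mul_div_cancel₀ _ hd.ne']
    rfl
  have hfield : ∀ k, ∀ᶠ d : ℕ in atTop, ∀ m, f d k m = speed κ d ((k : ℝ) / N)
      / noiseVar σ (dilation κ d ((k : ℝ) / N)) * ((σ ^ 2 - 1) * dilation κ d ((k : ℝ) / N) * m
        + bias p (dilation κ d ((k : ℝ) / N) * √(d : ℝ) * (√(d : ℝ) * m)
          / noiseVar σ (dilation κ d ((k : ℝ) / N)))) := by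
    intro k
    filter_upwards [eventually_sqrt_natCast_pos] with d hd m
    rw [hf]
    simp only [overlapDrift]
    field_simp
  refine Tendsto.congr' hpath (tendsto_gridPath (K := N) hN (tendsto_div_sqrt_natCast x)
    (fun k hk hm => ?_) ht.1 (by rw [div_self hN'.ne']; exact ht.2))
  -- Before `halfIndex` the drift is bounded on the scale `√d` and dies after division. At
  -- `halfIndex` the limit `B` is given. Afterwards the argument of `bias` is `d` times a quantity
  -- whose limit has the sign of `S`.
  rcases lt_or_ge k (halfIndex N) with hkj | hkj
  · rw [secondField_of_lt hkj]
    have h1 := tendsto_overlapDrift_of_lt hp hσ κ (lt_half_of_lt_halfIndex hkj)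
      (tendsto_overlapEuler hp hσ κ N x hkj.le)
    refine (h1.div_atTop tendsto_sqrt_natCast).congr' ?_
    filter_upwards [heul k] with d hd
    rw [hf]
    simp only [← hd]
    rfl
  have hhalf := half_le_of_halfIndex_le hN hkj
  have hV := noiseVar_limitDilation_pos hσ (hle k hk)
  have hmain : ∀ b, Tendsto (fun d : ℕ => bias p (dilation κ d ((k : ℝ) / N) * √(d : ℝ)
      * (√(d : ℝ) * gridEuler N (f d) k (x / √(d : ℝ)))
        / noiseVar σ (dilation κ d ((k : ℝ) / N)))) atTop (𝓝 b) →
      Tendsto (fun d => f d k (gridEuler N (f d) k (x / √(d : ℝ)))) atTop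
        (𝓝 (2 / noiseVar σ (limitDilation ((k : ℝ) / N)) *
          ((σ ^ 2 - 1) * limitDilation ((k : ℝ) / N)
            * gridEuler N (secondField σ N B S) k 0 + b))) := by
    intro b hb
    refine (((tendsto_speed_of_ge κ hhalf).div (tendsto_noiseVar σ κ _) hV.ne').mul
      ((((tendsto_dilation κ _).const_mul (σ ^ 2 - 1)).mul hm).add hb)).congr' ?_
    filter_upwards [hfield k] with d hd
    rw [hd]
    rfl
  rw [secondField, if_neg (not_lt.2 hkj)]
  refine hmain _ ?_
  rcases hkj.eq_or_lt with rfl | hkj'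
  · rw [if_pos rfl]
    refine hB.congr' ?_
    filter_upwards [heul (halfIndex N)] with d hd
    rw [hd]
  · rw [if_neg hkj'.ne']
    refine tendsto_bias_of_sign hp hS ?_
    have hpos := mul_gridEuler_secondField_pos hσ hN hrate hBS hS2 hkj' hk.le
    have hθ : 0 < limitDilation ((k : ℝ) / N) := by
      rw [limitDilation_of_ge hhalf]
      have h1 : N < 2 * k := by unfold halfIndex at hkj'; omega
      have h2 : (N : ℝ) < 2 * k := by exact_mod_cast h1
      have : 1 < 2 * ((k : ℝ) / N) := by rw [← mul_div_assoc, lt_div_iff₀ hN']; linarith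
      linarith
    have hc : Tendsto (fun d : ℕ => dilation κ d ((k : ℝ) / N)
        * (S * gridEuler N (f d) k (x / √(d : ℝ))) / noiseVar σ (dilation κ d ((k : ℝ) / N))) atTop
        (𝓝 (limitDilation ((k : ℝ) / N) * (S * gridEuler N (secondField σ N B S) k 0)
          / noiseVar σ (limitDilation ((k : ℝ) / N)))) :=
      ((tendsto_dilation κ _).mul (hm.const_mul S)).div (tendsto_noiseVar σ κ _) hV.ne'
    have := (tendsto_sqrt_natCast.atTop_mul_atTop₀ tendsto_sqrt_natCast).atTop_mul_pos
      (by positivity) hc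
    refine this.congr fun d => ?_
    ring

end SecondScheme

/-! ### Choice of the mode at the first step -/

section SecondBias

variable {p κ : ℝ}

lemma bias_one (u : ℝ) : bias 1 u = 1 := by simp [bias]

lemma bias_zero (u : ℝ) : bias 0 u = -1 := by simp [bias]

lemma strictMono_bias (h0 : 0 < p) (h1 : p < 1) : StrictMono (bias p) := by
  have hp : p ∈ Set.Icc (0 : ℝ) 1 := ⟨h0.le, h1.le⟩
  refine strictMono_of_hasDerivAt_pos (fun u => hasDerivAt_bias hp u) fun u => ?_
  have := bias_denom_pos hp u
  have : 0 < 1 - p := by linarith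
  positivity

lemma bias_eq_tanh {h : ℝ} (hp : p = Real.exp h / (Real.exp h + Real.exp (-h))) (u : ℝ) :
    bias p u = Real.tanh (h + u) := by
  have h1 : 1 - p = Real.exp (-h) / (Real.exp h + Real.exp (-h)) := by
    rw [hp]; have := Real.exp_pos h; have := Real.exp_pos (-h); field_simp; ring
  rw [bias, h1, hp, Real.tanh_eq_sinh_div_cosh, Real.sinh_eq, Real.cosh_eq, neg_add, Real.exp_add,
    Real.exp_add]
  have := Real.exp_pos h
  have := Real.exp_pos (-h)
  have := Real.exp_pos u
  have := Real.exp_pos (-u)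
  field_simp

/-- The limiting posterior mean of the sign at the first step of the second phase, as a function
of the normalized overlap: the case `e = 0` is for even numbers of steps. -/
def secondBias (e : ℕ) (p κ x : ℝ) : ℝ :=
  if e = 0 then bias p (κ * x) else if p = 1 then 1 else if p = 0 then -1 else Real.sign x

lemma secondBias_one (e : ℕ) (κ x : ℝ) : secondBias e 1 κ x = 1 := by
  simp [secondBias, bias_one]

lemma secondBias_zero (e : ℕ) (κ x : ℝ) : secondBias e 0 κ x = -1 := by
  simp [secondBias, bias_zero]

lemma abs_sign_le (x : ℝ) : |Real.sign x| ≤ 1 := by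
  rcases Real.sign_apply_eq x with h | h | h <;> rw [h] <;> norm_num

lemma abs_secondBias_le (hp : p ∈ Set.Icc (0 : ℝ) 1) (e : ℕ) (x : ℝ) :
    |secondBias e p κ x| ≤ 1 := by
  unfold secondBias
  split_ifs
  · exact abs_bias_le hp _
  · simp
  · simp
  · exact abs_sign_le x

lemma measurable_sign : Measurable Real.sign := by
  unfold Real.sign
  exact Measurable.ite (measurableSet_lt measurable_id measurable_const) measurable_const
    (Measurable.ite (measurableSet_lt measurable_const measurable_id) measurable_const
      measurable_const)

lemma measurable_secondBias (hp : p ∈ Set.Icc (0 : ℝ) 1) (e : ℕ) (κ : ℝ) :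
    Measurable (secondBias e p κ) := by
  have := (continuous_bias hp).measurable
  unfold secondBias
  split_ifs
  · fun_prop
  · fun_prop
  · fun_prop
  · exact measurable_sign

/-- At most one overlap leaves the mode undecided, and atomless laws do not see it. -/
lemma secondBias_zeros_subsingleton (hp : p ∈ Set.Icc (0 : ℝ) 1) (hκ : 0 < κ) (e : ℕ) :
    {x | secondBias e p κ x = 0}.Subsingleton := by
  intro x hx y hy
  rw [Set.mem_ofPred_eq] at hx hy
  rcases hp.1.eq_or_lt with rfl | h0
  · rw [secondBias_zero] at hx; norm_num at hx
  rcases hp.2.eq_or_lt with rfl | h1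
  · rw [secondBias_one] at hx; norm_num at hx
  rw [secondBias, if_neg h1.ne, if_neg h0.ne'] at hx hy
  split_ifs at hx hy with he
  · exact mul_left_cancel₀ hκ.ne' ((strictMono_bias h0 h1).injective (hx.trans hy.symm))
  · rw [Real.sign_eq_zero_iff] at hx hy
    rw [hx, hy]

lemma sign_secondBias_cases (e : ℕ) {x : ℝ} (hp : p ∈ Set.Icc (0 : ℝ) 1)
    (hx : secondBias e p κ x ≠ 0) :
    ((Real.sign (secondBias e p κ x) = 1 ∧ 0 < p) ∨ (Real.sign (secondBias e p κ x) = -1 ∧ p < 1))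
      ∧ 0 < Real.sign (secondBias e p κ x) * secondBias e p κ x := by
  rcases hx.lt_or_gt with h | h
  · rw [Real.sign_of_neg h]
    refine ⟨Or.inr ⟨rfl, lt_of_le_of_ne hp.2 ?_⟩, by linarith⟩
    rintro rfl
    rw [secondBias_one] at h
    linarith
  · rw [Real.sign_of_pos h]
    refine ⟨Or.inl ⟨rfl, lt_of_le_of_ne hp.1 ?_⟩, by linarith⟩
    rintro rfl
    rw [secondBias_zero] at h
    linarith

lemma sign_eventually_eq {ι : Type*} {l : Filter ι} {a : ι → ℝ} {b : ℝ} (ha : Tendsto a l (𝓝 b))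
    (hb : b ≠ 0) : ∀ᶠ i in l, Real.sign (a i) = Real.sign b := by
  rcases hb.lt_or_gt with h | h
  · filter_upwards [ha.eventually_lt_const h] with i hi
    rw [Real.sign_of_neg hi, Real.sign_of_neg h]
  · filter_upwards [ha.eventually_const_lt h] with i hi
    rw [Real.sign_of_pos hi, Real.sign_of_pos h]

/-- The limit `N → ∞` only needs the sign to be locally constant off the exceptional point. -/
lemma sign_secondBias_eventually_eq (hp : p ∈ Set.Icc (0 : ℝ) 1) (e : ℕ) {ι : Type*} {l : Filter ι}
    {a : ι → ℝ} {b : ℝ} (ha : Tendsto a l (𝓝 b)) (hb : secondBias e p κ b ≠ 0) :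
    ∀ᶠ i in l, Real.sign (secondBias e p κ (a i)) = Real.sign (secondBias e p κ b) := by
  unfold secondBias at *
  split_ifs at * with he h1 h0
  · exact sign_eventually_eq (((continuous_bias hp).tendsto _).comp (ha.const_mul κ)) hb
  · exact Eventually.of_forall fun _ => rfl
  · exact Eventually.of_forall fun _ => rfl
  · rw [Ne, Real.sign_eq_zero_iff] at hb
    filter_upwards [sign_eventually_eq ha hb] with i hi
    rw [hi]

end SecondBias

/-! ### The overlap when the second phase starts -/

section FirstScheme

variable {p κ : ℝ}

/-- Each Euler step is the identity plus a monotone map, because `bias` is monotone. Injectivity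
then keeps the exceptional set of starting points null. -/
lemma strictMono_firstEuler (hp : p ∈ Set.Icc (0 : ℝ) 1) (hκ : 0 < κ) (N k : ℕ) :
    StrictMono (firstEuler p κ N k) := by
  induction k with
  | zero => exact strictMono_id
  | succ k ih =>
    refine ih.add_monotone fun x y hxy => ?_
    have := monotone_bias hp (show 2 * κ * ((k : ℝ) / N) * firstEuler p κ N k x
      ≤ 2 * κ * ((k : ℝ) / N) * firstEuler p κ N k y by
        have := ih.monotone hxy; gcongr)
    simp only [smul_eq_mul, firstDrift]
    gcongr
    exact this

/-- On odd grids `halfIndex` overshoots time `1/2`, but by less than one step, at speed at most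
`2κ`. -/
lemma abs_firstEuler_halfIndex_sub_le (hp : p ∈ Set.Icc (0 : ℝ) 1) (hκ : 0 < κ) {N : ℕ}
    (hN : 0 < N) (x : ℝ) :
    |firstEuler p κ N (halfIndex N) x
      - gridPath N (fun k => firstDrift p κ ((k : ℝ) / N)) (1 / 2) x| ≤ 2 * κ / N := by
  have hN' : (0 : ℝ) < N := by exact_mod_cast hN
  have hhalf : 0 < halfIndex N := by unfold halfIndex; omega
  obtain ⟨k, hk⟩ : ∃ k, halfIndex N = k + 1 := ⟨_, (Nat.succ_pred_eq_of_pos hhalf).symm⟩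
  have h1 := (lt_half_of_lt_halfIndex (N := N) (k := k) (by omega)).le
  have h2 := half_le_of_halfIndex_le (k := k + 1) hN (by omega)
  rw [gridPath_of_mem hN _ _ h1 h2, hk, firstEuler, gridEuler]
  set v := firstDrift p κ ((k : ℝ) / N)
    (gridEuler N (fun k => firstDrift p κ ((k : ℝ) / N)) k x) with hv
  have hv' : |v| ≤ 2 * κ := abs_firstDrift_le hp hκ _ _
  have h3 : ((k + 1 : ℕ) : ℝ) / N - (k : ℝ) / N = 1 / N := by push_cast; ring
  rw [add_sub_add_left_eq_sub, ← sub_smul, smul_eq_mul, abs_mul, abs_of_nonneg (by linarith)]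
  calc _ ≤ 1 / (N : ℝ) * (2 * κ) := by gcongr; linarith
    _ = _ := by ring

lemma tendsto_firstEuler_halfIndex (hp : p ∈ Set.Icc (0 : ℝ) 1) (hκ : 0 < κ) {x y : ℝ}
    (h : Tendsto (fun N : ℕ => gridPath N (fun k => firstDrift p κ ((k : ℝ) / N)) (1 / 2) x) atTop
      (𝓝 y)) :
    Tendsto (fun N => firstEuler p κ N (halfIndex N) x) atTop (𝓝 y) := by
  refine h.congr_dist ?_
  refine squeeze_zero' (Eventually.of_forall fun _ => dist_nonneg) ?_
    (tendsto_const_nhds.div_atTop tendsto_natCast_atTop_atTop : Tendsto (fun N : ℕ =>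
      2 * κ / (N : ℝ)) atTop (𝓝 0))
  filter_upwards [eventually_gt_atTop 0] with N hN
  rw [dist_comm]
  exact abs_firstEuler_halfIndex_sub_le hp hκ hN x

lemma ae_secondBias_firstEuler_ne_zero (hp : p ∈ Set.Icc (0 : ℝ) 1) (hκ : 0 < κ) (e N k : ℕ) :
    ∀ᵐ x ∂gaussianReal 0 1, secondBias e p κ (firstEuler p κ N k x) ≠ 0 := by
  have := nullSingletonClass_gaussianReal (μ := 0) (v := 1) one_ne_zero
  rw [ae_iff]
  refine Set.Subsingleton.measure_zero ?_ _
  simp only [not_not]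
  exact (secondBias_zeros_subsingleton hp hκ e).preimage (strictMono_firstEuler hp hκ N k).injective

lemma ae_secondBias_realMixture_ne_zero (hp : p ∈ Set.Icc (0 : ℝ) 1) (hκ : 0 < κ) (e : ℕ) :
    ∀ᵐ x ∂realMixture p κ, secondBias e p κ x ≠ 0 := by
  have h := secondBias_zeros_subsingleton hp hκ e
  have h1 := nullSingletonClass_gaussianReal (μ := κ) (v := 1) one_ne_zero
  have h2 := nullSingletonClass_gaussianReal (μ := -κ) (v := 1) one_ne_zero
  rw [ae_iff]
  simp only [not_not, realMixture, Measure.add_apply, Measure.smul_apply, smul_eq_mul]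
  rw [h.measure_zero, h.measure_zero]
  simp

/-- The posterior mean of the sign at the first step of the second phase. -/
lemma tendsto_bias_halfIndex {σ : ℝ} (hp : p ∈ Set.Icc (0 : ℝ) 1) (hσ : 0 < σ) {e n : ℕ}
    (he : e = 0 ∨ e = 1) (hN : 0 < 2 * n + e) {x : ℝ}
    (hx : secondBias e p κ (firstEuler p κ (2 * n + e) (halfIndex (2 * n + e)) x) ≠ 0) :
    Tendsto (fun d : ℕ => bias p
      (dilation κ d ((halfIndex (2 * n + e) : ℝ) / (2 * n + e : ℕ)) * √(d : ℝ)
      * overlapEuler p σ κ d (2 * n + e) (halfIndex (2 * n + e)) x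
        / noiseVar σ (dilation κ d ((halfIndex (2 * n + e) : ℝ) / (2 * n + e : ℕ))))) atTop
      (𝓝 (secondBias e p κ (firstEuler p κ (2 * n + e) (halfIndex (2 * n + e)) x))) := by
  have hE := tendsto_overlapEuler hp hσ κ (2 * n + e) x (le_refl (halfIndex (2 * n + e)))
  set X := firstEuler p κ (2 * n + e) (halfIndex (2 * n + e)) x
  set s : ℝ := (halfIndex (2 * n + e) : ℝ) / (2 * n + e : ℕ) with hs
  -- On even grids the step starts at `1/2`, where dilation times `√d` is exactly `κ`. On odd grids
  -- it starts half a step later; the limiting dilation there is `1/N > 0` and the argument of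
  -- `bias` diverges like `√d`.
  rcases he with rfl | rfl
  · have hs2 : s = 1 / 2 := by
      have h1 : halfIndex (2 * n + 0) = n := by unfold halfIndex; omega
      have h2 : (0 : ℝ) < n := by exact_mod_cast (by omega : 0 < n)
      rw [hs, h1]; push_cast; field_simp; ring
    have hV : noiseVar σ (limitDilation s) = 1 := by
      rw [hs2, limitDilation_of_le le_rfl, noiseVar]; ring
    have h3 := (hE.const_mul κ).div (tendsto_noiseVar σ κ s) (by rw [hV]; exact one_ne_zero)
    rw [hV, div_one] at h3
    rw [secondBias, if_pos rfl]
    refine (((continuous_bias hp).tendsto _).comp h3).congr' ?_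
    filter_upwards [eventually_sqrt_natCast_pos] with d hd
    have h4 : dilation κ d s * √(d : ℝ) = κ := by
      rw [hs2, dilation, if_pos le_rfl]; field_simp
    rw [h4]
    rfl
  · rw [secondBias, if_neg one_ne_zero] at hx ⊢
    split_ifs at hx ⊢ with h1 h0
    · simp only [h1, bias_one]; exact tendsto_const_nhds
    · simp only [h0, bias_zero]; exact tendsto_const_nhds
    rw [Ne, Real.sign_eq_zero_iff] at hx
    have hN' : (0 : ℝ) < (2 * n + 1 : ℕ) := by exact_mod_cast hN
    have hs0 : 2 * s - 1 = 1 / (2 * n + 1 : ℕ) := by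
      have h1 : halfIndex (2 * n + 1) = n + 1 := by unfold halfIndex; omega
      rw [hs, h1]; field_simp; push_cast; ring
    have hs1 : s ≤ 1 := by
      rw [hs, div_le_one hN']
      exact_mod_cast (by unfold halfIndex; omega)
    have hθ : 0 < limitDilation s := by
      have : 0 < 1 / ((2 * n + 1 : ℕ) : ℝ) := by positivity
      rw [limitDilation_of_ge (by linarith), hs0]
      exact this
    have hV := noiseVar_limitDilation_pos hσ hs1
    have hc := ((tendsto_dilation κ s).mul (hE.const_mul (Real.sign X))).div
      (tendsto_noiseVar σ κ s) hV.ne'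
    have hSX : 0 < Real.sign X * X := by
      rcases Ne.lt_or_gt hx with h | h
      · rw [Real.sign_of_neg h]; linarith
      · rw [Real.sign_of_pos h]; linarith
    refine tendsto_bias_of_sign hp ?_
      ((tendsto_sqrt_natCast.atTop_mul_pos (by positivity) hc).congr fun d => ?_)
    · rcases Ne.lt_or_gt hx with h | h
      · exact Or.inr ⟨Real.sign_of_neg h, lt_of_le_of_ne hp.2 h1⟩
      · exact Or.inl ⟨Real.sign_of_pos h, lt_of_le_of_ne hp.1 (Ne.symm h0)⟩
    · simp only [Pi.div_apply]
      ring

end FirstScheme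

/-! ### The weights of the two modes -/

section SignWeight

variable {p κ : ℝ}

lemma realMixture_real_Ioi (hp : p ∈ Set.Icc (0 : ℝ) 1) (c : ℝ) :
    (realMixture p κ).real (Set.Ioi c) = 1 - mixtureCDF p κ (1 / 2) c := by
  have := isProbabilityMeasure_realMixture (κ := κ) hp
  rw [← Set.compl_Iic, probReal_compl_eq_one_sub measurableSet_Iic, Measure.real,
    realMixture_Iic hp, ENNReal.toReal_ofReal]
  have hp1 : 0 ≤ 1 - p := sub_nonneg.2 hp.2
  exact add_nonneg (mul_nonneg hp.1 (cdf_nonneg _ _)) (mul_nonneg hp1 (cdf_nonneg _ _))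

/-- The limiting weight of the mode `+ 1`. -/
def signWeight (p : ℝ) (e : ℕ) (κ : ℝ) : ℝ := (realMixture p κ).real {x | 0 < secondBias e p κ x}

/-- The components move off to `±∞` while the threshold converges, so only the component of weight
`p` remains above it. -/
lemma tendsto_realMixture_Ioi (hp : p ∈ Set.Icc (0 : ℝ) 1) {c : ℝ → ℝ} {a : ℝ}
    (hc : Tendsto c atTop (𝓝 a)) :
    Tendsto (fun κ => (realMixture p κ).real (Set.Ioi (c κ))) atTop (𝓝 p) := by
  simp only [realMixture_real_Ioi hp, mixtureCDF]
  have hl : Tendsto (fun κ : ℝ => 2 * κ * (1 / 2)) atTop atTop := by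
    refine tendsto_id.congr fun κ => ?_
    simp only [id]; ring
  have h1 : Tendsto (fun κ => c κ - 2 * κ * (1 / 2)) atTop atBot := by
    simp only [sub_eq_add_neg]
    exact hc.add_atBot (tendsto_neg_atTop_atBot.comp hl)
  have h2 : Tendsto (fun κ => c κ + 2 * κ * (1 / 2)) atTop atTop := hc.add_atTop hl
  have h3 := ((((tendsto_cdf_atBot (gaussianReal 0 1)).comp h1).const_mul p).add
    (((tendsto_cdf_atTop (gaussianReal 0 1)).comp h2).const_mul (1 - p))).const_sub 1
  simpa using h3

lemma exists_bias_pos_iff (h0 : 0 < p) (h1 : p < 1) : ∃ u₀, ∀ u, 0 < bias p u ↔ u₀ < u := by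
  have hq : 0 < (1 - p) / p := div_pos (by linarith) h0
  -- The threshold balances the two posterior weights, `p e^u = (1 - p) e^{-u}`.
  refine ⟨Real.log (√((1 - p) / p)), fun u => ?_⟩
  have hz : bias p (Real.log (√((1 - p) / p))) = 0 := by
    have hs := Real.sqrt_pos.2 hq
    rw [bias, Real.exp_neg, Real.exp_log hs, div_eq_zero_iff]
    left
    field_simp
    rw [Real.sq_sqrt hq.le]
    field_simp
    ring
  rw [← hz]
  exact (strictMono_bias h0 h1).lt_iff_lt

lemma tendsto_signWeight (hp : p ∈ Set.Icc (0 : ℝ) 1) (e : ℕ) :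
    Tendsto (signWeight p e) atTop (𝓝 p) := by
  rcases hp.1.eq_or_lt with rfl | h0
  · refine tendsto_const_nhds.congr fun κ => ?_
    have : {x | 0 < secondBias e 0 κ x} = ∅ := by
      ext x
      simp only [secondBias_zero, Set.mem_ofPred_eq, Set.mem_empty_iff_false, iff_false]
      norm_num
    rw [signWeight, this, measureReal_empty]
  rcases hp.2.eq_or_lt with rfl | h1
  · refine tendsto_const_nhds.congr fun κ => ?_
    have : {x | 0 < secondBias e 1 κ x} = Set.univ := by
      ext x
      simp only [secondBias_one, Set.mem_ofPred_eq, Set.mem_univ, iff_true]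
      exact one_pos
    have := isProbabilityMeasure_realMixture (κ := κ) hp
    rw [signWeight, ‹{x | 0 < secondBias e 1 κ x} = _›, probReal_univ]
  by_cases he : e = 0
  · obtain ⟨u₀, hu⟩ := exists_bias_pos_iff h0 h1
    refine (tendsto_realMixture_Ioi hp (tendsto_id.const_div_atTop u₀)).congr' ?_
    filter_upwards [eventually_gt_atTop 0] with κ hκ
    rw [signWeight]
    congr 1
    ext x
    simp only [secondBias, if_pos he, Set.mem_ofPred_eq, Set.mem_Ioi, hu, id]
    rw [div_lt_iff₀ hκ, mul_comm]
  · refine (tendsto_realMixture_Ioi hp (tendsto_const_nhds (x := (0 : ℝ)))).congr fun κ => ?_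
    rw [signWeight]
    congr 1
    ext x
    simp only [secondBias, if_neg he, if_neg h1.ne, if_neg h0.ne', Set.mem_ofPred_eq, Set.mem_Ioi]
    constructor
    · intro h; rw [Real.sign_of_pos h]; exact one_pos
    · intro h
      by_contra hx
      rcases (not_lt.1 hx).lt_or_eq with h' | rfl
      · rw [Real.sign_of_neg h'] at h; linarith
      · simp at h

lemma signWeight_mem (hp : p ∈ Set.Icc (0 : ℝ) 1) (e : ℕ) (κ : ℝ) :
    signWeight p e κ ∈ Set.Icc (0 : ℝ) 1 := by
  have := isProbabilityMeasure_realMixture (κ := κ) hp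
  exact ⟨measureReal_nonneg, measureReal_le_one⟩

lemma map_sign_eq_dirac {ν : Measure ℝ} [IsProbabilityMeasure ν] {g : ℝ → ℝ} (hg : Measurable g)
    (hne : ∀ᵐ x ∂ν, g x ≠ 0) :
    ν.map (fun x => Real.sign (g x)) = ENNReal.ofReal (ν.real {x | 0 < g x}) • Measure.dirac 1
      + ENNReal.ofReal (1 - ν.real {x | 0 < g x}) • Measure.dirac (-1) := by
  have hs : MeasurableSet {x | 0 < g x} := measurableSet_lt measurable_const hg
  have hcompl : ENNReal.ofReal (1 - ν.real {x | 0 < g x}) = ν {x | 0 < g x}ᶜ := by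
    rw [← probReal_compl_eq_one_sub hs, ofReal_measureReal]
  rw [hcompl, ofReal_measureReal]
  ext A hA
  have hm : Measurable fun x => Real.sign (g x) := measurable_sign.comp hg
  rw [Measure.map_apply hm hA, ← measure_inter_add_sdiff _ hs]
  simp only [Measure.add_apply, Measure.smul_apply, smul_eq_mul, Measure.dirac_apply' _ hA]
  congr 1
  · by_cases h1 : (1 : ℝ) ∈ A
    · rw [Set.indicator_of_mem h1, Pi.one_apply, mul_one]
      congr 1
      ext x
      simp only [Set.mem_inter_iff, Set.mem_preimage, Set.mem_ofPred_eq, and_iff_right_iff_imp]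
      intro hx
      rwa [Real.sign_of_pos hx]
    · rw [Set.indicator_of_notMem h1, mul_zero]
      convert measure_empty (μ := ν)
      ext x
      simp only [Set.mem_inter_iff, Set.mem_preimage, Set.mem_ofPred_eq, Set.mem_empty_iff_false,
        iff_false, not_and]
      intro hx hx0
      rw [Real.sign_of_pos hx0] at hx
      exact h1 hx
  · by_cases h1 : (-1 : ℝ) ∈ A
    · rw [Set.indicator_of_mem h1, Pi.one_apply, mul_one]
      refine measure_congr ?_
      filter_upwards [hne] with x hx
      refine propext ⟨fun h => h.2, fun h => ⟨?_, h⟩⟩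
      have : g x < 0 := lt_of_le_of_ne (not_lt.1 h) hx
      change Real.sign (g x) ∈ A
      rwa [Real.sign_of_neg this]
    · rw [Set.indicator_of_notMem h1, mul_zero]
      rw [measure_eq_zero_iff_ae_notMem]
      filter_upwards [hne] with x hx h
      have : g x < 0 := lt_of_le_of_ne (not_lt.1 h.2) hx
      have h2 : Real.sign (g x) ∈ A := h.1
      rw [Real.sign_of_neg this] at h2
      exact h1 h2

end SignWeight

/-! ### The iterated limits and the theorem -/

section Main

variable {p σ κ : ℝ} {r : (d : ℕ) → Space d}

lemma eventually_lt_sqrt_natCast (κ : ℝ) : ∀ᶠ d : ℕ in atTop, κ < √(d : ℝ) :=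
  tendsto_sqrt_natCast.eventually_gt_atTop κ

lemma aemeasurable_overlapPath (hp : p ∈ Set.Icc (0 : ℝ) 1) (σ κ : ℝ) (d N : ℕ) (c : ℝ) {m : ℕ}
    (T : Fin m → ℝ) : AEMeasurable (fun ω i => overlapPath p σ κ d N (T i) ω / c)
      (gaussianReal 0 1) := by
  have hc : ∀ t, Continuous (overlapPath p σ κ d N t) := fun t =>
    continuous_gridPath (fun k => continuous_overlapDrift hp σ κ d _) t
  have : Continuous (fun ω => fun i => overlapPath p σ κ d N (T i) ω / c) := by fun_prop
  exact this.measurable.aemeasurable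

theorem iteratedLimitInLaw_first (hp : p ∈ Set.Icc (0 : ℝ) 1) (hσ : 0 < σ) (hκ : 0 < κ)
    (hr : ∀ d, ‖r d‖ ^ 2 = (d : ℝ)) {μ : ℝ → ℝ → ℝ}
    (hμ : ∀ x, ∀ t ∈ Set.Icc (0 : ℝ) (1 / 2), Tendsto (fun N : ℕ =>
        gridPath N (fun k => firstDrift p κ ((k : ℝ) / N)) t x) atTop (𝓝 (μ t x)))
    {m : ℕ} {T : Fin m → ℝ} (hT : ∀ i, T i ∈ Set.Icc (0 : ℝ) (1 / 2)) :
    IteratedLimitInLaw (fun N d => overlapLaw p σ κ (r d) N (√(d : ℝ)) T)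
      ((gaussianReal 0 1).map fun ω i => μ (T i) ω) := by
  refine iteratedLimitInLaw_of_ae (fun N d => isProbabilityMeasure_overlapLaw p σ κ (r d) N _ T)
    (Y := fun N d ω i => overlapPath p σ κ d N (T i) ω / 1)
    (Z := fun N ω i => gridPath N (fun k => firstDrift p κ ((k : ℝ) / N)) (T i) ω)
    (fun N d => aemeasurable_overlapPath hp σ κ d N 1 T) ?_ ?_ (fun N => ?_) ?_
  · filter_upwards [eventually_gt_atTop 0] with N hN
    filter_upwards [eventually_lt_sqrt_natCast κ] with d hd
    rw [← overlapLaw_eq hp hσ hκ hd (hr d) hN 1 fun i => ⟨(hT i).1, by linarith [(hT i).2]⟩, mul_one]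
  · filter_upwards [eventually_gt_atTop 0] with N hN
    refine ae_of_all _ fun ω => tendsto_pi_nhds.2 fun i => ?_
    simp only [div_one]
    exact tendsto_overlapPath hp hσ κ hN ω (hT i)
  · have hc : ∀ t, Continuous (gridPath N (fun k => firstDrift p κ ((k : ℝ) / N)) t) := fun t =>
      continuous_gridPath (fun k => continuous_firstDrift hp κ _) t
    have : Continuous (fun ω => fun i =>
      gridPath N (fun k => firstDrift p κ ((k : ℝ) / N)) (T i) ω) := by fun_prop
    exact this.measurable.aemeasurable
  · exact ae_of_all _ fun ω => tendsto_pi_nhds.2 fun i => hμ ω _ (hT i)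

lemma measurable_secondField {N : ℕ} {B S M : ℝ → ℝ} (hB : Measurable B) (hS : Measurable S)
    (hM : Measurable M) (k : ℕ) : Measurable fun ω => secondField σ N (B ω) (S ω) k (M ω) := by
  unfold secondField
  split_ifs <;> fun_prop

lemma measurable_gridPath_secondField {N : ℕ} {B S : ℝ → ℝ} (hB : Measurable B)
    (hS : Measurable S) (t : ℝ) :
    Measurable fun ω => gridPath N (secondField σ N (B ω) (S ω)) t 0 := by
  have h : ∀ k, Measurable fun ω => gridEuler N (secondField σ N (B ω) (S ω)) k 0 := by
    intro k
    induction k with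
    | zero => exact measurable_const
    | succ k ih => exact ih.add ((measurable_secondField hB hS ih k).const_smul (1 / (N : ℝ)))
  exact (h _).add ((measurable_secondField hB hS (h _) _).const_smul (t - (⌊t * N⌋₊ : ℝ) / N))

/-- The limit of the overlap in the second phase, in terms of the overlap at time `1 / 2`. -/
def secondFlow (p κ : ℝ) (e : ℕ) (t x : ℝ) : ℝ := Real.sign (secondBias e p κ x) * (2 * t - 1)

/-- For fixed large `N` the mode is chosen by the overlap `X n` of the Euler scheme. As `X n` tends
to `ψ`, almost surely this choice is eventually the one made by `ψ`. -/
theorem iteratedLimitInLaw_second (hp : p ∈ Set.Icc (0 : ℝ) 1) (hσ : 0 < σ) (hκ : 0 < κ)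
    (hr : ∀ d, ‖r d‖ ^ 2 = (d : ℝ)) {ψ : ℝ → ℝ} (hψm : Measurable ψ)
    (hψ : ∀ x, Tendsto (fun N : ℕ =>
        gridPath N (fun k => firstDrift p κ ((k : ℝ) / N)) (1 / 2) x) atTop (𝓝 (ψ x)))
    (hlaw : (gaussianReal 0 1).map ψ = realMixture p κ) {e : ℕ} (he : e = 0 ∨ e = 1)
    {m : ℕ} {T : Fin m → ℝ} (hT : ∀ i, T i ∈ Set.Icc (1 / 2 : ℝ) 1) :
    IteratedLimitInLaw (fun n d => overlapLaw p σ κ (r d) (2 * n + e) (d : ℝ) T)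
      ((gaussianReal 0 1).map fun ω i => secondFlow p κ e (T i) (ψ ω)) := by
  have hT' : ∀ i, T i ∈ Set.Icc (0 : ℝ) 1 := fun i => ⟨by linarith [(hT i).1], (hT i).2⟩
  have hN : Tendsto (fun n : ℕ => 2 * n + e) atTop atTop :=
    tendsto_atTop_mono (fun n => by simp only [id]; omega) tendsto_id
  obtain ⟨C, -, hC⟩ := exists_bound_limitRate hσ
  set X : ℕ → ℝ → ℝ := fun n => firstEuler p κ (2 * n + e) (halfIndex (2 * n + e)) with hX
  have hXm : ∀ n, Measurable (X n) := fun n => (strictMono_firstEuler hp hκ _ _).monotone.measurable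
  have hBm : ∀ n, Measurable fun ω => secondBias e p κ (X n ω) := fun n =>
    (measurable_secondBias hp e κ).comp (hXm n)
  refine iteratedLimitInLaw_of_ae (fun n d => isProbabilityMeasure_overlapLaw p σ κ (r d) _ _ T)
    (Y := fun n d ω i => overlapPath p σ κ d (2 * n + e) (T i) ω / √(d : ℝ))
    (Z := fun n ω i => gridPath (2 * n + e) (secondField σ (2 * n + e) (secondBias e p κ (X n ω))
      (Real.sign (secondBias e p κ (X n ω)))) (T i) 0)
    (fun n d => aemeasurable_overlapPath hp σ κ d _ _ T) ?_ ?_ (fun n => ?_) ?_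
  · filter_upwards [hN.eventually_gt_atTop 0] with n hn
    filter_upwards [eventually_lt_sqrt_natCast κ] with d hd
    rw [← overlapLaw_eq hp hσ hκ hd (hr d) hn (√(d : ℝ)) hT', Real.mul_self_sqrt d.cast_nonneg]
  · filter_upwards [hN.eventually_gt_atTop 0,
      ((tendsto_natCast_atTop_atTop (R := ℝ)).comp hN).eventually_ge_atTop C] with n hn hn2
    filter_upwards [ae_secondBias_firstEuler_ne_zero hp hκ e (2 * n + e) (halfIndex (2 * n + e))]
      with ω hω
    obtain ⟨hS, hBS⟩ := sign_secondBias_cases e hp hω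
    exact tendsto_pi_nhds.2 fun i => tendsto_overlapPath_div hp hσ hn
      (fun θ hθ => (hC θ hθ).trans hn2) hS hBS (tendsto_bias_halfIndex hp hσ he hn hω) (hT' i)
  · refine (measurable_pi_lambda _ fun i => ?_).aemeasurable
    exact measurable_gridPath_secondField (hBm n) (measurable_sign.comp (hBm n)) _
  · have hne : ∀ᵐ ω ∂gaussianReal 0 1, secondBias e p κ (ψ ω) ≠ 0 := by
      have := ae_secondBias_realMixture_ne_zero hp hκ e
      rw [← hlaw] at this
      exact ae_of_ae_map hψm.aemeasurable this
    filter_upwards [hne] with ω hω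
    refine tendsto_pi_nhds.2 fun i => ?_
    have hXl : Tendsto (fun n => X n ω) atTop (𝓝 (ψ ω)) :=
      (tendsto_firstEuler_halfIndex hp hκ (hψ ω)).comp hN
    refine (tendsto_gridPath_secondField hσ (hT i) hN
      (B := fun n => secondBias e p κ (X n ω)) (fun n => abs_secondBias_le hp e _)
      (abs_sign_le (secondBias e p κ (ψ ω)))).congr' ?_
    filter_upwards [sign_secondBias_eventually_eq hp e hXl hω] with n hn
    rw [hn]

/-- With `M = S θ`, `θ = 2t - 1`, the right-hand side is `2 S ((σ² - 1) θ² + 1) / V = 2 S`. -/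
lemma hasDerivAt_secondFlow (hσ : 0 < σ) {e : ℕ} {x : ℝ} (hx : secondBias e p κ x ≠ 0) {t : ℝ}
    (ht : t ∈ Set.Ioo (1 / 2 : ℝ) 1) :
    HasDerivAt (fun u => secondFlow p κ e u x)
      (2 * (σ ^ 2 - 1) * (2 * t - 1) / (1 + (σ ^ 2 - 1) * (2 * t - 1) ^ 2) * secondFlow p κ e t x
        + 2 * Real.sign (secondFlow p κ e t x) / (1 + (σ ^ 2 - 1) * (2 * t - 1) ^ 2)) t := by
  have hθ : 0 < 2 * t - 1 := by linarith [ht.1]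
  have hV : 0 < 1 + (σ ^ 2 - 1) * (2 * t - 1) ^ 2 :=
    noiseVar_pos hσ hθ.le (by linarith [ht.2])
  have hsign : Real.sign (secondFlow p κ e t x) = Real.sign (secondBias e p κ x) := by
    unfold secondFlow
    rcases hx.lt_or_gt with h | h
    · rw [Real.sign_of_neg h, Real.sign_of_neg (by linarith)]
    · rw [Real.sign_of_pos h, Real.sign_of_pos (by linarith)]
  rw [hsign]
  have := (((hasDerivAt_id t).const_mul 2).sub_const 1).const_mul (Real.sign (secondBias e p κ x))
  refine this.congr_deriv ?_
  unfold secondFlow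
  field_simp
  ring

end Main

end DilatedVP

end

open DilatedVP in
theorem theorem5 (p : ℝ) (hp : p ∈ Set.Icc (0 : ℝ) 1) :
    ∃ pκ : ℕ → ℝ → ℝ,
      (∀ e ∈ ({0, 1} : Set ℕ), Tendsto (pκ e) atTop (𝓝 p)) ∧
      ∀ σ : ℝ, 0 < σ →
      ∀ r : (d : ℕ) → Space d, (∀ d, ‖r d‖ ^ 2 = (d : ℝ)) →
      ∀ κ : ℝ, 0 < κ →
        -- orthogonal component
        (∃ s : ℕ → ℕ → ℝ → ℝ,
          (∀ N d t, 0 ≤ s N d t) ∧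
          (∀ N d : ℕ, 0 < N → κ < √(d : ℝ) → ∀ t ∈ Set.Icc (0 : ℝ) 1,
            orthLaw p σ κ (r d) N t = orthGaussian (r d) (s N d t)) ∧
          (∀ t ∈ Set.Icc (0 : ℝ) (1 / 2), IteratedLimit (fun N d => s N d t) 1) ∧
          (∀ t ∈ Set.Icc (1 / 2 : ℝ) 1,
            IteratedLimit (fun N d => s N d t) (√(1 + (σ ^ 2 - 1) * (2 * t - 1) ^ 2)))) ∧
        -- component along `r`, first phase
        (∃ (Ω : Type) (_ : MeasurableSpace Ω) (P : Measure Ω) (μ : ℝ → Ω → ℝ),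
          IsProbabilityMeasure P ∧ (∀ t, Measurable (μ t)) ∧
          (∀ (m : ℕ) (T : Fin m → ℝ), (∀ i, T i ∈ Set.Icc (0 : ℝ) (1 / 2)) →
            IteratedLimitInLaw (fun N d => overlapLaw p σ κ (r d) N (√(d : ℝ)) T)
              (P.map fun ω i => μ (T i) ω)) ∧
          P.map (μ 0) = gaussianReal 0 1 ∧
          (∀ h : ℝ, p = Real.exp h / (Real.exp h + Real.exp (-h)) →
            ∀ᵐ ω ∂P, ∀ t ∈ Set.Icc (0 : ℝ) (1 / 2),
              HasDerivWithinAt (fun u => μ u ω)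
                (2 * κ * Real.tanh (h + 2 * κ * t * μ t ω)) (Set.Icc 0 (1 / 2)) t) ∧
          (p = 1 → ∀ᵐ ω ∂P, ∀ t ∈ Set.Icc (0 : ℝ) (1 / 2),
            HasDerivWithinAt (fun u => μ u ω) (2 * κ) (Set.Icc 0 (1 / 2)) t) ∧
          (p = 0 → ∀ᵐ ω ∂P, ∀ t ∈ Set.Icc (0 : ℝ) (1 / 2),
            HasDerivWithinAt (fun u => μ u ω) (-(2 * κ)) (Set.Icc 0 (1 / 2)) t) ∧
          P.map (μ (1 / 2)) = ENNReal.ofReal p • gaussianReal κ 1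
            + ENNReal.ofReal (1 - p) • gaussianReal (-κ) 1) ∧
        -- component along `r`, second phase; `N = 2 n + e` steps, parity `e` fixed
        (∀ e ∈ ({0, 1} : Set ℕ),
          ∃ (Ω : Type) (_ : MeasurableSpace Ω) (P : Measure Ω) (M : ℝ → Ω → ℝ),
          IsProbabilityMeasure P ∧ (∀ t, Measurable (M t)) ∧
          (∀ (m : ℕ) (T : Fin m → ℝ), (∀ i, T i ∈ Set.Icc (1 / 2 : ℝ) 1) →
            IteratedLimitInLaw (fun n d => overlapLaw p σ κ (r d) (2 * n + e) (d : ℝ) T)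
              (P.map fun ω i => M (T i) ω)) ∧
          (∀ᵐ ω ∂P, ContinuousOn (fun t => M t ω) (Set.Icc (1 / 2) 1) ∧
            ∀ t ∈ Set.Ioo (1 / 2 : ℝ) 1,
              HasDerivAt (fun u => M u ω)
                (2 * (σ ^ 2 - 1) * (2 * t - 1) / (1 + (σ ^ 2 - 1) * (2 * t - 1) ^ 2) * M t ω
                  + 2 * Real.sign (M t ω) / (1 + (σ ^ 2 - 1) * (2 * t - 1) ^ 2)) t) ∧
          pκ e κ ∈ Set.Icc (0 : ℝ) 1 ∧
          P.map (M 1) = ENNReal.ofReal (pκ e κ) • Measure.dirac 1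
            + ENNReal.ofReal (1 - pκ e κ) • Measure.dirac (-1)) := by
  -- The weight involves only `p`, the parity and `κ`, so it can be chosen before `σ` and `r`.
  refine ⟨signWeight p, fun e _ => tendsto_signWeight hp e, fun σ hσ r hr κ hκ => ?_⟩
  obtain ⟨μ, hμm, hμ0, hμd, hμl, hμlaw⟩ := exists_firstFlow hp hκ
  refine ⟨⟨fun N d t => |orthPath σ κ d N t|, fun N d t => abs_nonneg _,
    fun N d hN hd t ht => orthLaw_eq hp hσ hκ hd (hr d) hN ht, fun t ht => ?_, fun t ht => ?_⟩,
    ⟨ℝ, inferInstance, gaussianReal 0 1, μ, inferInstance, hμm,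
      fun m T hT => iteratedLimitInLaw_first hp hσ hκ hr hμl hT, ?_, fun h hph => ?_,
      fun hp1 => ?_, fun hp0 => ?_, hμlaw⟩, fun e he => ?_⟩
  · have := iteratedLimit_orthPath hσ κ (t := t) ⟨ht.1, by linarith [ht.2]⟩
    rw [limitDilation_of_le ht.2] at this
    simpa [noiseVar] using this
  · have := iteratedLimit_orthPath hσ κ (t := t) ⟨by linarith [ht.1], ht.2⟩
    rwa [limitDilation_of_ge ht.1] at this
  · have : μ 0 = id := funext hμ0
    rw [this, Measure.map_id]
  · refine ae_of_all _ fun ω t ht => ?_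
    rw [← bias_eq_tanh hph]
    exact hμd ω t ht
  · refine ae_of_all _ fun ω t ht => (hμd ω t ht).congr_deriv ?_
    rw [firstDrift, hp1, bias_one, mul_one]
  · refine ae_of_all _ fun ω t ht => (hμd ω t ht).congr_deriv ?_
    rw [firstDrift, hp0, bias_zero]
    ring
  · have hhalf : (1 / 2 : ℝ) ∈ Set.Icc (0 : ℝ) (1 / 2) := by norm_num
    have hm : Measurable fun x => Real.sign (secondBias e p κ x) :=
      measurable_sign.comp (measurable_secondBias hp e κ)
    refine ⟨ℝ, inferInstance, gaussianReal 0 1, fun t ω => secondFlow p κ e t (μ (1 / 2) ω),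
      inferInstance, fun t => (hm.comp (hμm _)).mul_const _, fun m T hT =>
        iteratedLimitInLaw_second hp hσ hκ hr (hμm _) (fun x => hμl x _ hhalf) hμlaw
          (by simpa using he) hT, ?_, signWeight_mem hp e κ, ?_⟩
    · have hne := ae_secondBias_realMixture_ne_zero hp hκ e
      rw [← hμlaw] at hne
      filter_upwards [ae_of_ae_map (hμm _).aemeasurable hne] with ω hω
      refine ⟨Continuous.continuousOn ?_, fun t ht => hasDerivAt_secondFlow hσ hω ht⟩
      unfold secondFlow
      fun_prop
    · have := isProbabilityMeasure_realMixture (κ := κ) hp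
      rw [signWeight, ← map_sign_eq_dirac (measurable_secondBias hp e κ)
        (ae_secondBias_realMixture_ne_zero hp hκ e), ← hμlaw, Measure.map_map hm (hμm _)]
      congr 1
      ext ω
      simp only [secondFlow, Function.comp_apply]
      ring
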